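/- **Theorem (Generalized Cauchy Integral Formula).** Let $U\subset\mathbb{C}$ be a bounded contractible open set, let $f:U\to\mathbb{C}$ be holomorphic, let $r\ge 1$, let $J\in\hat{\mathcal B}_1^r(\mathbb{R}^2)$ be a closed differential $1$-chain of order $r$ (that is, $\partial J=0$) with $\operatorname{supp}(J)\subseteq U$, and let $z\in U\setminus\operatorname{supp}(J)$. Then the Harrison integrals below are well defined and $$\operatorname{Ind}_J(z)\,f(z)=\frac{1}{2\pi i}\int_J\frac{f(w)}{w-z}\,dw,\qquad\text{where}\quad \operatorname{Ind}_J(z):=\frac{1}{2\pi i}\int_J\frac{dw}{w-z}.$$ Here $\mathbb{C}\simeq\mathbb{R}^2$. A pointed $k$-chain is a finite formal sum $A=\sum_i(p_i;\alpha_i)$ with $p_i\in\mathbb{R}^2$, $\alpha_i\in\Lambda^k\mathbb{R}^2$ (a finitely supported section of $\Lambda^kT\mathbb{R}^2$). For $u\in\mathbb{R}^2$ let $\Delta_u(p;\alpha)=(p+u;\alpha)-(p;\alpha)$, extended linearly, let $\Delta_U^j=\Delta_{u_1}\circ\dots\circ\Delta_{u_j}$ for $U=(u_1,\dots,u_j)$,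 and $|\Delta^j_U(p;\alpha)|_j=\|u_1\|\cdots\|u_j\|\,\|\alpha\|$, with $\|\alpha\|$ the mass of $\alpha$. The $r$-norm is $$\|A\|_{B^r}=\inf\Big\{\sum_i|\Delta_{U_i}^{j_i}(p_i;\alpha_i)|_{j_i}\;:\;A=\sum_i\Delta_{U_i}^{j_i}(p_i;\alpha_i),\ 0\le j_i\le r\Big\},$$ and $\hat{\mathcal B}_k^r(\mathbb{R}^2)$ is the completion of the space of pointed $k$-chains in this norm. A closed set $X$ supports $J$ if for every non-empty open $W\supseteq X$ the chain $J$ is a limit in $\hat{\mathcal B}_k^r(\mathbb{R}^2)$ of pointed chains in $W$; $\operatorname{supp}(J)$ is the intersection of all closed sets supporting $J$. The boundary $\partial:\hat{\mathcal B}_1^r\to\hat{\mathcal B}_0^{r+1}$ is $\partial=\sum_{i=1}^2P_{e_i}\circ E_{e_i}^\dagger$, where $(e_1,e_2)$ is the standard basis, $E_v^\dagger(p;\alpha)=(p;\langle v,\alpha\rangle)$ and $P_v(p;\alpha)=\lim_{t\to0}\big((p+tv;\alpha/t)-(p;\alpha/t)\big)$, both extended by linearity and continuity. $\mathcal B_1^r(\mathbb{R}^2)$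 is the space of $1$-forms $\omega$, here complex-valued, such that $|\omega(\Delta_U^j(p;\alpha))|$ is bounded over all difference chains with $|\Delta_U^j(p;\alpha)|_j=1$, $0\le j\le r$; for such $\omega$ the Harrison integral $\int_J\omega$ is the value at $J$ of the continuous extension of $\sum_i(p_i;\alpha_i)\mapsto\sum_i\omega_{p_i}(\alpha_i)$. For a form $\omega$ defined only near $\operatorname{supp}(J)$, $\int_J\omega$ is the integral over $J$ of any form in $\mathcal B_1^r(\mathbb{R}^2)$ that agrees with $\omega$ on a neighbourhood of $\operatorname{supp}(J)$; "well defined" means that such a form exists and that the value does not depend on its choice. -/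

import Mathlib

open Filter Topology

noncomputable section

namespace DiffChain

variable {V V' F : Type*} [NormedAddCommGroup V] [NormedSpace ℝ V]
  [NormedAddCommGroup V'] [NormedSpace ℝ V'] [NormedAddCommGroup F] [NormedSpace ℝ F]

/-! ### Pointed chains in the plane

The ambient space is `ℝ² = ℂ`. A pointed `k`-chain is a finitely supported section of `Λᵏ Tℝ²`.
For `k = 1` the fibre is `V = ℂ` (tangent vectors, whose mass is the Euclidean length) and for
`k = 0` it is `V = ℝ` (whose mass is the absolute value). The simple chain `(p; α)` is
`Finsupp.single p α`. -/

/-- Pointed chains in `ℝ² = ℂ` whose fibres are `V`. -/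
abbrev PointedChain (V : Type*) [NormedAddCommGroup V] : Type _ := ℂ →₀ V

/-- The translation operator `T_u (p; α) = (p + u; α)`. -/
def translation (u : ℂ) : PointedChain V →ₗ[ℝ] PointedChain V :=
  Finsupp.lmapDomain V ℝ (fun p => p + u)

/-- The difference operator `Δ_u = T_u - Id`. -/
def difference (u : ℂ) : PointedChain V →ₗ[ℝ] PointedChain V :=
  translation u - LinearMap.id

/-- The iterated difference operator `Δ_{u₁} ∘ ⋯ ∘ Δ_{uⱼ}` for `U = [u₁, …, uⱼ]`. -/
def iterDifference : List ℂ → PointedChain V →ₗ[ℝ] PointedChain V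
  | [] => LinearMap.id
  | u :: U => (difference u).comp (iterDifference U)

/-- The difference chain `Δ_U^j (p; α)` given by the data `(U, p, α)`. -/
def differenceChain (d : List ℂ × ℂ × V) : PointedChain V :=
  iterDifference d.1 (Finsupp.single d.2.1 d.2.2)

/-- The weight `|Δ_U^j (p; α)|_j = ‖u₁‖ ⋯ ‖uⱼ‖ ‖α‖`. -/
def weight (d : List ℂ × ℂ × V) : ℝ := (d.1.map (‖·‖)).prod * ‖d.2.2‖

/-- `D` is a way of writing `A` as a finite sum of difference chains of order at most `r`. -/
def IsDecomposition (r : ℕ) (A : PointedChain V) (D : List (List ℂ × ℂ × V)) : Prop :=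
  (∀ d ∈ D, d.1.length ≤ r) ∧ A = (D.map differenceChain).sum

/-- The norm `‖A‖_{B^r}`: the infimum of the total weights of all decompositions of `A` into
difference chains of order at most `r`. -/
def rNorm (r : ℕ) (A : PointedChain V) : ℝ :=
  sInf {s | ∃ D, IsDecomposition r A D ∧ s = (D.map weight).sum}

lemma weight_nonneg {W : Type*} [NormedAddCommGroup W] (d : List ℂ × ℂ × W) : 0 ≤ weight d :=
  mul_nonneg (List.prod_nonneg (by simp)) (norm_nonneg _)

lemma sum_weight_nonneg {W : Type*} [NormedAddCommGroup W] (D : List (List ℂ × ℂ × W)) : 0 ≤ (D.map weight).sum :=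
  List.sum_nonneg (by
    intro x hx
    obtain ⟨d, -, rfl⟩ := List.mem_map.1 hx
    exact weight_nonneg d)

lemma bddBelow_weights (r : ℕ) (A : PointedChain V) :
    BddBelow {s | ∃ D, IsDecomposition r A D ∧ s = (D.map weight).sum} :=
  ⟨0, by rintro s ⟨D, -, rfl⟩; exact sum_weight_nonneg D⟩

lemma exists_decomposition (r : ℕ) (A : PointedChain V) : ∃ D, IsDecomposition r A D := by
  induction A using Finsupp.induction_linear with
  | zero => exact ⟨[], by simp [IsDecomposition]⟩
  | add A B hA hB =>
    obtain ⟨D, hD⟩ := hA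
    obtain ⟨D', hD'⟩ := hB
    refine ⟨D ++ D', ?_, by simp [hD.2, hD'.2]⟩
    intro d hd
    rcases List.mem_append.1 hd with h | h
    · exact hD.1 d h
    · exact hD'.1 d h
  | single p α =>
    exact ⟨[([], p, α)], by simp, by simp [differenceChain, iterDifference]⟩

lemma rNorm_nonneg (r : ℕ) (A : PointedChain V) : 0 ≤ rNorm r A :=
  Real.sInf_nonneg (by rintro s ⟨D, -, rfl⟩; exact sum_weight_nonneg D)

lemma rNorm_le {r : ℕ} {A : PointedChain V} {D : List (List ℂ × ℂ × V)}
    (hD : IsDecomposition r A D) : rNorm r A ≤ (D.map weight).sum :=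
  csInf_le (bddBelow_weights r A) ⟨D, hD, rfl⟩

lemma exists_lt_of_rNorm (r : ℕ) (A : PointedChain V) {ε : ℝ} (hε : 0 < ε) :
    ∃ D, IsDecomposition r A D ∧ (D.map weight).sum < rNorm r A + ε := by
  obtain ⟨D₀, hD₀⟩ := exists_decomposition r A
  obtain ⟨s, ⟨D, hD, rfl⟩, hs⟩ := exists_lt_of_csInf_lt
    (s := {s | ∃ D, IsDecomposition r A D ∧ s = (D.map weight).sum})
    ⟨_, D₀, hD₀, rfl⟩ (lt_add_of_pos_right (rNorm r A) hε)
  exact ⟨D, hD, hs⟩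

lemma rNorm_differenceChain_le {r : ℕ} (d : List ℂ × ℂ × V) (hd : d.1.length ≤ r) :
    rNorm r (differenceChain d) ≤ weight d := by
  simpa using rNorm_le (r := r) (D := [d]) ⟨by simpa using hd, by simp⟩

lemma rNorm_add_le (r : ℕ) (A B : PointedChain V) : rNorm r (A + B) ≤ rNorm r A + rNorm r B := by
  refine le_of_forall_pos_le_add fun ε hε => ?_
  obtain ⟨D, hD, h⟩ := exists_lt_of_rNorm r A (half_pos hε)
  obtain ⟨D', hD', h'⟩ := exists_lt_of_rNorm r B (half_pos hε)
  have := rNorm_le (r := r) (A := A + B) (D := D ++ D') ⟨by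
    intro d hd
    rcases List.mem_append.1 hd with h | h
    · exact hD.1 d h
    · exact hD'.1 d h, by simp [hD.2, hD'.2]⟩
  simp only [List.map_append, List.sum_append] at this
  linarith

lemma rNorm_smul_le (r : ℕ) (c : ℝ) (A : PointedChain V) : rNorm r (c • A) ≤ |c| * rNorm r A := by
  have key : ∀ D, IsDecomposition r A D → rNorm r (c • A) ≤ |c| * (D.map weight).sum := by
    intro D hD
    have h := rNorm_le (r := r) (A := c • A) (D := D.map fun d => (d.1, d.2.1, c • d.2.2)) ⟨by
      intro d hd
      obtain ⟨e, he, rfl⟩ := List.mem_map.1 hd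
      exact hD.1 e he, by
      rw [hD.2, List.smul_sum, List.map_map, List.map_map]
      congr 1
      refine List.map_congr_left fun d _ => ?_
      simp only [Function.comp_apply, differenceChain]
      rw [← map_smul, Finsupp.smul_single]⟩
    refine h.trans (le_of_eq ?_)
    rw [← List.sum_map_mul_left, List.map_map]
    congr 1
    refine List.map_congr_left fun d _ => ?_
    simp [weight, norm_smul]
    ring
  refine le_of_forall_pos_le_add fun ε hε => ?_
  obtain ⟨D, hD, h⟩ := exists_lt_of_rNorm r A (ε := ε / (|c| + 1)) (by positivity)
  refine (key D hD).trans ((mul_le_mul_of_nonneg_left h.le (abs_nonneg c)).trans ?_)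
  rw [mul_add]
  gcongr
  rw [mul_div_assoc', div_le_iff₀ (by positivity)]
  nlinarith

/-! ### The Banach spaces of differential chains -/

/-- The space of pointed chains, carrying the `r`-norm. -/
def NormedPointedChain (_r : ℕ) (V : Type*) [NormedAddCommGroup V] : Type _ := PointedChain V

instance (r : ℕ) : AddCommGroup (NormedPointedChain r V) :=
  inferInstanceAs (AddCommGroup (PointedChain V))

instance (r : ℕ) : Module ℝ (NormedPointedChain r V) :=
  inferInstanceAs (Module ℝ (PointedChain V))

instance (r : ℕ) : Norm (NormedPointedChain r V) := ⟨fun A => rNorm r (V := V) A⟩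

lemma seminormedSpaceCore (r : ℕ) : SeminormedSpace.Core ℝ (NormedPointedChain r V) where
  norm_nonneg A := rNorm_nonneg r (V := V) A
  norm_triangle A B := rNorm_add_le r (V := V) A B
  norm_smul c A := by
    refine le_antisymm (rNorm_smul_le r (V := V) c A) ?_
    rcases eq_or_ne c 0 with rfl | hc
    · rw [norm_zero, zero_mul]
      exact rNorm_nonneg r (V := V) _
    · have h : ‖A‖ ≤ |c⁻¹| * ‖c • A‖ := by
        have h' : ‖c⁻¹ • c • A‖ ≤ |c⁻¹| * ‖c • A‖ := rNorm_smul_le r (V := V) c⁻¹ _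
        rwa [smul_smul, inv_mul_cancel₀ hc, one_smul] at h'
      rw [abs_inv, ← div_eq_inv_mul, le_div_iff₀ (abs_pos.2 hc)] at h
      rwa [Real.norm_eq_abs, mul_comm]

instance (r : ℕ) : SeminormedAddCommGroup (NormedPointedChain r V) :=
  SeminormedAddCommGroup.ofCore (seminormedSpaceCore r)

instance (r : ℕ) : NormedSpace ℝ (NormedPointedChain r V) where
  norm_smul_le c A := ((seminormedSpaceCore r).norm_smul c A).le

/-- Differential chains of order `r`: the completion of the pointed chains in the `r`-norm.
`Chain r ℂ` is the space of differential `1`-chains of order `r` in `ℝ²`, and `Chain r ℝ` the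
space of differential `0`-chains of order `r`. -/
abbrev Chain (r : ℕ) (V : Type*) [NormedAddCommGroup V] [NormedSpace ℝ V] : Type _ :=
  UniformSpace.Completion (NormedPointedChain r V)

/-- A pointed chain, viewed as a differential chain of order `r`. -/
def ofPointed (r : ℕ) : PointedChain V →ₗ[ℝ] Chain r V :=
  (UniformSpace.Completion.toComplL (𝕜 := ℝ) (E := NormedPointedChain r V)).toLinearMap

lemma norm_ofPointed (r : ℕ) (A : PointedChain V) : ‖ofPointed r A‖ = rNorm r A :=
  UniformSpace.Completion.norm_coe (E := NormedPointedChain r V) A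

lemma denseRange_ofPointed (r : ℕ) : DenseRange (ofPointed r : PointedChain V → Chain r V) :=
  UniformSpace.Completion.denseRange_coe (α := NormedPointedChain r V)

/-- A linear map that is bounded on difference chains is bounded in the `r`-norm. -/
lemma norm_le_of_differenceChain {r : ℕ} {L : PointedChain V →ₗ[ℝ] F} {C : ℝ} (hC : 0 ≤ C)
    (h : ∀ d : List ℂ × ℂ × V, d.1.length ≤ r → ‖L (differenceChain d)‖ ≤ C * weight d)
    (A : PointedChain V) : ‖L A‖ ≤ C * ‖ofPointed r A‖ := by
  rw [norm_ofPointed]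
  have key : ∀ D, IsDecomposition r A D → ‖L A‖ ≤ C * (D.map weight).sum := by
    rintro D ⟨hD, rfl⟩
    induction D with
    | nil => simp
    | cons d D ih =>
      simp only [List.map_cons, List.sum_cons, map_add, mul_add]
      refine (norm_add_le _ _).trans (add_le_add (h d (hD d (by simp))) ?_)
      exact ih fun e he => hD e (by simp [he])
  refine le_of_forall_pos_le_add fun ε hε => ?_
  obtain ⟨D, hD, hs⟩ := exists_lt_of_rNorm r A (ε := ε / (C + 1)) (by positivity)
  refine (key D hD).trans ((mul_le_mul_of_nonneg_left hs.le hC).trans ?_)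
  rw [mul_add]
  gcongr
  rw [mul_div_assoc', div_le_iff₀ (by positivity)]
  nlinarith

/-- The continuous extension to `Chain r V` of a linear map on pointed chains that is bounded in
the `r`-norm. -/
def extend [CompleteSpace F] (r : ℕ) (L : PointedChain V →ₗ[ℝ] F) : Chain r V →L[ℝ] F :=
  L.extendOfNorm (ofPointed r)

lemma extend_ofPointed [CompleteSpace F] {r : ℕ} {L : PointedChain V →ₗ[ℝ] F} {C : ℝ}
    (hC : 0 ≤ C)
    (h : ∀ d : List ℂ × ℂ × V, d.1.length ≤ r → ‖L (differenceChain d)‖ ≤ C * weight d)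
    (A : PointedChain V) : extend r L (ofPointed r A) = L A :=
  LinearMap.extendOfNorm_eq (denseRange_ofPointed r) ⟨C, norm_le_of_differenceChain hC h⟩ A

lemma norm_extend_le [CompleteSpace F] {r : ℕ} {L : PointedChain V →ₗ[ℝ] F} {C : ℝ}
    (hC : 0 ≤ C)
    (h : ∀ d : List ℂ × ℂ × V, d.1.length ≤ r → ‖L (differenceChain d)‖ ≤ C * weight d)
    (J : Chain r V) : ‖extend r L J‖ ≤ C * ‖J‖ :=
  LinearMap.norm_extendOfNorm_apply_le (denseRange_ofPointed r) C
    (norm_le_of_differenceChain hC h) J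

/-! ### Support -/

/-- The closed set `X` supports `J`: for every non-empty open `W ⊇ X` the chain `J` is a limit, in
the `r`-norm, of pointed chains in `W`. -/
def IsSupportedBy {r : ℕ} (J : Chain r V) (X : Set ℂ) : Prop :=
  IsClosed X ∧ ∀ W : Set ℂ, IsOpen W → W.Nonempty → X ⊆ W →
    ∃ A : ℕ → PointedChain V, (∀ i, (↑(A i).support : Set ℂ) ⊆ W) ∧
      Tendsto (fun i => ofPointed r (A i)) atTop (𝓝 J)

/-- The support of a differential chain: the intersection of all closed sets supporting it. -/
def supp {r : ℕ} (J : Chain r V) : Set ℂ := ⋂₀ {X | IsSupportedBy J X}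

/-! ### Operators -/

/-- The operator induced by a linear map of the fibres, `(p; α) ↦ (p; T α)`. -/
def mapFibre (T : V →L[ℝ] V') : PointedChain V →ₗ[ℝ] PointedChain V' :=
  Finsupp.mapRange.linearMap T.toLinearMap

/-- Retraction `E_v†` on `1`-chains, the continuous extension of `(p; α) ↦ (p; ⟨v, α⟩)`. -/
def retraction {r : ℕ} (v : ℂ) : Chain r ℂ →L[ℝ] Chain r ℝ :=
  extend r ((ofPointed r).comp (mapFibre (innerSL ℝ v)))

/-- The operator `A ↦ t⁻¹ Δ_{tv} A`, which sends `(p; α)` to `(p + tv; α/t) - (p; α/t)`,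
extended by continuity to a map from chains of order `r` to chains of order `r + 1`. -/
def differenceQuotient {r : ℕ} (v : ℂ) (t : ℝ) : Chain r V →L[ℝ] Chain (r + 1) V :=
  extend r ((ofPointed (r + 1)).comp (t⁻¹ • difference (t • v)))

/-- The prederivative `P_v J = lim_{t → 0} t⁻¹ Δ_{tv} J`. For `r ≥ 1` the limit exists for every
chain `J` (see `tendsto_differenceQuotient`), and `P_v` is the continuous extension of
`(p; α) ↦ lim_{t → 0} ((p + tv; α/t) - (p; α/t))`. -/
def prederivative {r : ℕ} (v : ℂ) (J : Chain r V) : Chain (r + 1) V :=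
  limUnder (𝓝[≠] (0 : ℝ)) fun t => differenceQuotient v t J

/-- The boundary `∂ = P_{e₁} ∘ E_{e₁}† + P_{e₂} ∘ E_{e₂}†` of a `1`-chain, where `e₁ = 1` and
`e₂ = i`. -/
def boundary {r : ℕ} (J : Chain r ℂ) : Chain (r + 1) ℝ :=
  prederivative 1 (retraction 1 J) + prederivative Complex.I (retraction Complex.I J)

lemma difference_single (u p : ℂ) (α : V) :
    difference u (Finsupp.single p α) = Finsupp.single (p + u) α - Finsupp.single p α := by
  simp [difference, translation, Finsupp.mapDomain_single]

lemma mapFibre_difference (T : V →L[ℝ] V') (u : ℂ) (A : PointedChain V) :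
    mapFibre T (difference u A) = difference u (mapFibre T A) := by
  induction A using Finsupp.induction_linear with
  | zero => simp
  | add A B hA hB => simp only [map_add, hA, hB]
  | single p α =>
    have h : ∀ (q : ℂ) (β : V), mapFibre T (Finsupp.single q β) = Finsupp.single q (T β) := by
      intro q β
      simp [mapFibre]
    rw [difference_single, map_sub, h, h, difference_single]

lemma mapFibre_differenceChain (T : V →L[ℝ] V') (d : List ℂ × ℂ × V) :
    mapFibre T (differenceChain d) = differenceChain (d.1, d.2.1, T d.2.2) := by
  obtain ⟨U, p, α⟩ := d
  induction U with
  | nil => simp [differenceChain, iterDifference, mapFibre]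
  | cons u U ih =>
    simp only [differenceChain, iterDifference, LinearMap.comp_apply] at ih ⊢
    rw [mapFibre_difference, ih]

lemma norm_mapFibre_differenceChain_le (T : V →L[ℝ] V') {r : ℕ} (d : List ℂ × ℂ × V)
    (hd : d.1.length ≤ r) :
    ‖((ofPointed r).comp (mapFibre T)) (differenceChain d)‖ ≤ ‖T‖ * weight d := by
  rw [LinearMap.comp_apply, mapFibre_differenceChain, norm_ofPointed]
  refine (rNorm_differenceChain_le (d.1, d.2.1, T d.2.2) hd).trans ?_
  have h := T.le_opNorm d.2.2
  have h' : 0 ≤ (d.1.map (‖·‖)).prod := List.prod_nonneg (by simp)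
  calc (d.1.map (‖·‖)).prod * ‖T d.2.2‖ ≤ (d.1.map (‖·‖)).prod * (‖T‖ * ‖d.2.2‖) := by gcongr
    _ = ‖T‖ * weight d := by simp only [weight]; ring

lemma retraction_ofPointed {r : ℕ} (v : ℂ) (A : PointedChain ℂ) :
    retraction v (ofPointed r A) = ofPointed r (mapFibre (innerSL ℝ v) A) :=
  extend_ofPointed (norm_nonneg _) (norm_mapFibre_differenceChain_le _) A

lemma norm_differenceQuotient_differenceChain_le {r : ℕ} (v : ℂ) (t : ℝ) (d : List ℂ × ℂ × V)
    (hd : d.1.length ≤ r) :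
    ‖((ofPointed (r + 1)).comp (t⁻¹ • difference (t • v))) (differenceChain d)‖ ≤
      ‖v‖ * weight d := by
  rw [LinearMap.comp_apply, LinearMap.smul_apply, map_smul, norm_smul]
  have h : difference (t • v) (differenceChain d) =
      differenceChain (t • v :: d.1, d.2.1, d.2.2) := rfl
  rw [h, norm_ofPointed]
  have h2 := rNorm_differenceChain_le (r := r + 1) (t • v :: d.1, d.2.1, d.2.2) (by simpa using hd)
  have h3 : weight (t • v :: d.1, d.2.1, d.2.2) = |t| * (‖v‖ * weight d) := by
    simp [weight]; ring
  rw [h3] at h2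
  refine (mul_le_mul_of_nonneg_left h2 (norm_nonneg _)).trans ?_
  have h4 : 0 ≤ ‖v‖ * weight d := mul_nonneg (norm_nonneg _) (weight_nonneg d)
  rcases eq_or_ne t 0 with rfl | ht
  · simpa using h4
  · rw [norm_inv, Real.norm_eq_abs, ← mul_assoc, inv_mul_cancel₀ (abs_ne_zero.2 ht), one_mul]

lemma differenceQuotient_ofPointed {r : ℕ} (v : ℂ) (t : ℝ) (A : PointedChain V) :
    differenceQuotient v t (ofPointed r A) = ofPointed (r + 1) (t⁻¹ • difference (t • v) A) :=
  extend_ofPointed (norm_nonneg v) (norm_differenceQuotient_differenceChain_le v t) A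

lemma norm_differenceQuotient_le {r : ℕ} (v : ℂ) (t : ℝ) (J : Chain r V) :
    ‖differenceQuotient v t J‖ ≤ ‖v‖ * ‖J‖ :=
  norm_extend_le (norm_nonneg v) (norm_differenceQuotient_differenceChain_le v t) J

/-- A curve in a Banach space with bounded first and second difference quotients is
differentiable at `0`. -/
lemma exists_tendsto_slope {X : Type*} [NormedAddCommGroup X] [NormedSpace ℝ X] [CompleteSpace X]
    (φ : ℝ → X) (M N : ℝ) (h1 : ∀ a h, ‖φ (a + h) - φ a‖ ≤ |h| * M)
    (h2 : ∀ h k, ‖φ (h + k) - φ h - φ k + φ 0‖ ≤ |h| * |k| * N) :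
    ∃ l, Tendsto (fun t : ℝ => t⁻¹ • (φ t - φ 0)) (𝓝[≠] 0) (𝓝 l) := by
  have hM : 0 ≤ M := by simpa using (norm_nonneg _).trans (h1 0 1)
  have hN : 0 ≤ N := by simpa using (norm_nonneg _).trans (h2 1 1)
  have hcont : Continuous φ := by
    refine (LipschitzWith.of_dist_le_mul (K := ⟨M, hM⟩) fun x y => ?_).continuous
    have := h1 y (x - y)
    rw [add_sub_cancel] at this
    rw [dist_eq_norm, Real.dist_eq, mul_comm]
    exact this
  have hint : ∀ a b, IntervalIntegrable φ MeasureTheory.volume a b := fun a b =>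
    hcont.intervalIntegrable a b
  have hloc : ∀ h : ℝ, 0 < h → ∀ ε : ℝ, 0 < ε → ∀ᶠ t in 𝓝[≠] (0 : ℝ),
      ‖t⁻¹ • (φ t - φ 0) - h⁻¹ • (φ h - φ 0)‖ ≤ h * N + ε := by
    intro h hh ε hε
    have hd0 : HasDerivAt (fun x => ∫ s in (0 : ℝ)..x, φ s) (φ 0) 0 :=
      intervalIntegral.integral_hasDerivAt_right (hint _ _)
        (hcont.stronglyMeasurableAtFilter _ _) hcont.continuousAt
    have hdh : HasDerivAt (fun x => ∫ s in (0 : ℝ)..x, φ s) (φ h) (0 + h) := by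
      rw [zero_add]
      exact intervalIntegral.integral_hasDerivAt_right (hint _ _)
        (hcont.stronglyMeasurableAtFilter _ _) hcont.continuousAt
    have hd := (hdh.comp_add_const 0 h).sub hd0
    rw [hasDerivAt_iff_tendsto_slope] at hd
    have hlim := hd.const_smul h⁻¹
    rw [Metric.tendsto_nhds] at hlim
    filter_upwards [hlim ε hε, self_mem_nhdsWithin] with t ht ht0
    have ht0 : t ≠ 0 := ht0
    set q := h⁻¹ • slope ((fun x => ∫ s in (0 : ℝ)..x + h, φ s) - fun x => ∫ s in (0 : ℝ)..x, φ s)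
      0 t with hq
    have hq' : q = (h⁻¹ * t⁻¹) • ∫ s in (0 : ℝ)..h, (φ (s + t) - φ s) := by
      have i1 : IntervalIntegrable (fun s => φ (s + t)) MeasureTheory.volume 0 h :=
        (hcont.comp (continuous_add_const t)).intervalIntegrable _ _
      rw [intervalIntegral.integral_sub i1 (hint _ _), hq, slope_def_module, smul_smul,
        intervalIntegral.integral_comp_add_right]
      simp only [Pi.sub_apply, sub_zero, zero_add, intervalIntegral.integral_same]
      congr 1
      have e1 := intervalIntegral.integral_add_adjacent_intervals (hint 0 t) (hint t (t + h))
      rw [add_comm h t, ← e1]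
      abel
    have hdiff : t⁻¹ • (φ t - φ 0) - q =
        -((h⁻¹ * t⁻¹) • ∫ s in (0 : ℝ)..h, (φ (s + t) - φ s - φ t + φ 0)) := by
      have e : ∀ s, φ (s + t) - φ s - φ t + φ 0 = (φ (s + t) - φ s) - (φ t - φ 0) := by
        intro s; abel
      simp only [e]
      have i1 : IntervalIntegrable (fun s => φ (s + t) - φ s) MeasureTheory.volume 0 h :=
        ((hcont.comp (continuous_add_const t)).sub hcont).intervalIntegrable _ _
      rw [intervalIntegral.integral_sub i1 intervalIntegrable_const, intervalIntegral.integral_const,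
        smul_sub (h⁻¹ * t⁻¹), smul_smul, ← hq']
      have e' : h⁻¹ * t⁻¹ * (h - 0) = t⁻¹ := by field_simp; ring
      rw [e']
      abel
    have hb : ‖∫ s in (0 : ℝ)..h, (φ (s + t) - φ s - φ t + φ 0)‖ ≤ (h * |t| * N) * |h - 0| := by
      refine intervalIntegral.norm_integral_le_of_norm_le_const fun s hs => ?_
      rw [Set.uIoc_of_le hh.le] at hs
      refine (h2 s t).trans ?_
      rw [abs_of_pos hs.1]
      gcongr
      exact hs.2
    have hb2 : ‖t⁻¹ • (φ t - φ 0) - q‖ ≤ h * N := by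
      rw [hdiff, norm_neg, norm_smul]
      refine (mul_le_mul_of_nonneg_left hb (norm_nonneg _)).trans (le_of_eq ?_)
      have : |t| ≠ 0 := abs_ne_zero.2 ht0
      rw [norm_mul, norm_inv, norm_inv, Real.norm_eq_abs, Real.norm_eq_abs, sub_zero,
        abs_of_pos hh]
      field_simp
    rw [dist_eq_norm] at ht
    calc ‖t⁻¹ • (φ t - φ 0) - h⁻¹ • (φ h - φ 0)‖
        = ‖(t⁻¹ • (φ t - φ 0) - q) + (q - h⁻¹ • (φ h - φ 0))‖ := by congr 1; abel
      _ ≤ h * N + ε := (norm_add_le _ _).trans (add_le_add hb2 ht.le)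
  have hcau : Cauchy (map (fun t : ℝ => t⁻¹ • (φ t - φ 0)) (𝓝[≠] 0)) := by
    rw [Metric.cauchy_iff]
    refine ⟨inferInstance, fun ε hε => ?_⟩
    have hh : 0 < ε / (8 * (N + 1)) := by positivity
    have hN' : ε / (8 * (N + 1)) * N ≤ ε / 8 := by
      rw [div_mul_eq_mul_div, div_le_div_iff₀ (by positivity) (by norm_num)]
      nlinarith
    refine ⟨_, image_mem_map (hloc _ hh (ε / 8) (by positivity)), ?_⟩
    rintro _ ⟨s, hs, rfl⟩ _ ⟨t, ht, rfl⟩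
    simp only [Set.mem_ofPred_eq, ← dist_eq_norm] at hs ht
    have := dist_triangle_right (s⁻¹ • (φ s - φ 0)) (t⁻¹ • (φ t - φ 0)) _ |>.trans
      (add_le_add hs ht)
    linarith
  exact cauchy_map_iff_exists_tendsto.1 hcau

/-- The limit defining the prederivative exists on all chains of order `r ≥ 1`. -/
theorem tendsto_differenceQuotient {r : ℕ} (hr : 1 ≤ r) (v : ℂ) (J : Chain r V) :
    Tendsto (fun t : ℝ => differenceQuotient v t J) (𝓝[≠] 0) (𝓝 (prederivative v J)) := by
  refine tendsto_nhds_limUnder ?_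
  have hpt : ∀ A : PointedChain V, ∃ l, Tendsto
      (fun t : ℝ => differenceQuotient v t (ofPointed r A)) (𝓝[≠] 0) (𝓝 l) := by
    intro A
    induction A using Finsupp.induction_linear with
    | zero => exact ⟨0, by simp⟩
    | add A B hA hB =>
      obtain ⟨a, ha⟩ := hA
      obtain ⟨b, hb⟩ := hB
      exact ⟨a + b, by simpa only [map_add] using ha.add hb⟩
    | single p α =>
      obtain ⟨l, hl⟩ := exists_tendsto_slope
        (fun t : ℝ => ofPointed (r + 1) (Finsupp.single (p + t • v) α)) (‖v‖ * ‖α‖)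
        (‖v‖ * ‖v‖ * ‖α‖) (by
          intro a h
          have := rNorm_differenceChain_le (r := r + 1) ([h • v], p + a • v, α) (by simp)
          rw [← norm_ofPointed] at this
          simp only [differenceChain, iterDifference, LinearMap.comp_apply, LinearMap.id_apply,
            difference_single, weight, List.map_cons, List.map_nil, List.prod_cons, List.prod_nil,
            norm_smul, map_sub, Real.norm_eq_abs, mul_one] at this
          rw [add_assoc, ← add_smul, mul_assoc] at this
          exact this) (by
          intro h k
          have := rNorm_differenceChain_le (r := r + 1) ([h • v, k • v], p, α)
            (by simp; omega)
          rw [← norm_ofPointed] at this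
          simp only [differenceChain, iterDifference, LinearMap.comp_apply, LinearMap.id_apply,
            difference_single, weight, List.map_cons, List.map_nil, List.prod_cons, List.prod_nil,
            norm_smul, map_sub, Real.norm_eq_abs, mul_one] at this
          rw [add_assoc, ← add_smul, add_comm k h] at this
          refine (le_of_eq ?_).trans (this.trans (le_of_eq ?_))
          · rw [zero_smul, add_zero]
            congr 1
            abel
          · ring)
      refine ⟨l, hl.congr fun t => ?_⟩
      rw [differenceQuotient_ofPointed, difference_single]
      simp
  rw [← cauchy_map_iff_exists_tendsto, Metric.cauchy_iff]
  refine ⟨inferInstance, fun ε hε => ?_⟩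
  obtain ⟨A, hA⟩ := Metric.denseRange_iff.1 (denseRange_ofPointed (V := V) r) J
    (ε / (4 * (‖v‖ + 1))) (by positivity)
  obtain ⟨l, hl⟩ := hpt A
  have hclose : ∀ t : ℝ, dist (differenceQuotient v t J)
      (differenceQuotient v t (ofPointed r A)) ≤ ε / 4 := by
    intro t
    rw [dist_eq_norm, ← map_sub]
    refine (norm_differenceQuotient_le v t _).trans ?_
    rw [dist_eq_norm] at hA
    refine (mul_le_mul_of_nonneg_left hA.le (norm_nonneg v)).trans ?_
    rw [mul_div_assoc', div_le_div_iff₀ (by positivity) (by norm_num)]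
    nlinarith [norm_nonneg v]
  refine ⟨_, image_mem_map (Metric.tendsto_nhds.1 hl (ε / 4) (by positivity)), ?_⟩
  rintro _ ⟨s, hs, rfl⟩ _ ⟨t, ht, rfl⟩
  simp only [Set.mem_ofPred_eq] at hs ht
  have h1 := dist_triangle_right (differenceQuotient v s J) l
    (differenceQuotient v s (ofPointed r A))
  have h2 := hclose s
  have h3 := hclose t
  have h4 := dist_triangle (differenceQuotient v s J) (differenceQuotient v s (ofPointed r A)) l
  have h5 := dist_triangle (differenceQuotient v t J) (differenceQuotient v t (ofPointed r A)) l
  have h6 := dist_triangle_right (differenceQuotient v s J) (differenceQuotient v t J) l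
  linarith

/-! ### Forms and the Harrison integral -/

/-- The value `∑ ω_{pᵢ}(αᵢ)` of a form on a pointed chain `∑ (pᵢ; αᵢ)`. -/
def evalPointed (ω : ℂ → V →L[ℝ] F) : PointedChain V →ₗ[ℝ] F :=
  Finsupp.lsum ℝ fun p => (ω p).toLinearMap

/-- `ω ∈ 𝓑^r(ℝ²)`: the norm `‖ω‖_{B^r}`, the supremum of `|ω(Δ_U^j (p; α))|` over all difference
chains with `|Δ_U^j (p; α)|_j = 1` and `0 ≤ j ≤ r`, is finite. A complex-valued form (`F = ℂ`) is in
this space exactly when its real and imaginary parts are, and its integral is the sum of the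
integral of the real part and `i` times the integral of the imaginary part. -/
def IsBForm (r : ℕ) (ω : ℂ → V →L[ℝ] F) : Prop :=
  ∃ C : ℝ, ∀ d : List ℂ × ℂ × V, d.1.length ≤ r → weight d = 1 →
    ‖evalPointed ω (differenceChain d)‖ ≤ C

/-- The Harrison integral `⨍_J ω = ω(J)` for `ω ∈ 𝓑^r(ℝ²)`: the value at `J` of the continuous
extension of `ω` from pointed chains. -/
def integralB [CompleteSpace F] {r : ℕ} (ω : ℂ → V →L[ℝ] F) (J : Chain r V) : F :=
  extend r (evalPointed ω) J

lemma differenceChain_eq_zero (d : List ℂ × ℂ × V) (h : weight d = 0) :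
    differenceChain d = 0 := by
  obtain ⟨U, p, α⟩ := d
  induction U with
  | nil =>
    have : α = 0 := by simpa [weight] using h
    simp [differenceChain, this]
  | cons u U ih =>
    simp only [differenceChain, iterDifference, LinearMap.comp_apply] at ih ⊢
    have h' : ‖u‖ * weight (U, p, α) = 0 := by
      rw [← h]; simp [weight, mul_assoc]
    rcases mul_eq_zero.1 h' with h0 | h0
    · have hid : translation (V := V) 0 = LinearMap.id := by
        ext q
        simp [translation]
      simp [difference, norm_eq_zero.1 h0, hid]
    · rw [ih h0, map_zero]

lemma integralB_ofPointed [CompleteSpace F] {r : ℕ} {ω : ℂ → V →L[ℝ] F} (hω : IsBForm r ω)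
    (A : PointedChain V) : integralB ω (ofPointed r A) = evalPointed ω A := by
  obtain ⟨C, hC⟩ := hω
  refine extend_ofPointed (C := max C 0) (le_max_right _ _) (fun d hd => ?_) A
  obtain ⟨U, p, α⟩ := d
  rcases eq_or_ne (weight (U, p, α)) 0 with h | h
  · simp [differenceChain_eq_zero _ h, h]
  · have hs : differenceChain (U, p, α) =
        weight (U, p, α) • differenceChain (U, p, (weight (U, p, α))⁻¹ • α) := by
      simp only [differenceChain]
      rw [← map_smul, Finsupp.smul_single, smul_smul, mul_inv_cancel₀ h, one_smul]
    have hw : weight (U, p, (weight (U, p, α))⁻¹ • α) = 1 := by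
      have h0 := weight_nonneg (U, p, α)
      have : weight (U, p, (weight (U, p, α))⁻¹ • α) =
          (weight (U, p, α))⁻¹ * weight (U, p, α) := by
        conv_lhs => rw [weight]
        simp only [norm_smul, norm_inv, Real.norm_eq_abs, abs_of_nonneg h0]
        conv_rhs => rw [weight]
        simp only [weight]
        ring
      rw [this, inv_mul_cancel₀ h]
    rw [hs, map_smul, norm_smul, Real.norm_eq_abs, abs_of_nonneg (weight_nonneg _), mul_comm]
    refine mul_le_mul_of_nonneg_right ?_ (weight_nonneg _)
    exact (hC (U, p, (weight (U, p, α))⁻¹ • α) hd hw).trans (le_max_left _ _)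

/-- The integral commutes with continuous linear maps of the values. For `F = ℂ`, applied to `Re`
and `Im`, this says `⨍_J ω = ⨍_J Re ω + i ⨍_J Im ω`. -/
lemma integralB_comp [CompleteSpace F] {F' : Type*} [NormedAddCommGroup F'] [NormedSpace ℝ F']
    [CompleteSpace F'] (T : F →L[ℝ] F') {r : ℕ} {ω : ℂ → V →L[ℝ] F} (hω : IsBForm r ω)
    (J : Chain r V) :
    IsBForm r (fun p => T.comp (ω p)) ∧
      integralB (fun p => T.comp (ω p)) J = T (integralB ω J) := by
  have he : ∀ A, evalPointed (fun p => T.comp (ω p)) A = T (evalPointed ω A) := by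
    intro A
    induction A using Finsupp.induction_linear with
    | zero => simp
    | add A B hA hB => simp only [map_add, hA, hB]
    | single p α => simp [evalPointed]
  have hb : IsBForm r (fun p => T.comp (ω p)) := by
    obtain ⟨C, hC⟩ := hω
    refine ⟨‖T‖ * C, fun d hd hw => ?_⟩
    rw [he]
    exact (T.le_opNorm _).trans (mul_le_mul_of_nonneg_left (hC d hd hw) (norm_nonneg T))
  refine ⟨hb, ?_⟩
  refine (denseRange_ofPointed r).induction_on J ?_ fun A => ?_
  · exact isClosed_eq (extend r _).continuous (T.continuous.comp (extend r _).continuous)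
  · rw [integralB_ofPointed hb, integralB_ofPointed hω, he]

/-- `η` is a form in `𝓑^r(ℝ²)` that agrees with `ω` on a neighbourhood of the support of `J`. -/
def IsExtensionNear {r : ℕ} (J : Chain r V) (ω η : ℂ → V →L[ℝ] F) : Prop :=
  IsBForm r η ∧ ∀ᶠ w in 𝓝ˢ (supp J), η w = ω w

/-- The Harrison integral over `J` of a form `ω` which is only defined near the support of `J` (the
values of `ω` elsewhere play no role) exists and equals `I`: there are forms in `𝓑^r(ℝ²)` that agree
with `ω` near the support of `J`, and all of them have integral `I` over `J`. -/
def HasHarrisonIntegral [CompleteSpace F] {r : ℕ} (J : Chain r V) (ω : ℂ → V →L[ℝ] F) (I : F) :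
    Prop :=
  (∃ η, IsExtensionNear J ω η) ∧ ∀ η, IsExtensionNear J ω η → integralB η J = I

/-- The Harrison integral of `ω` over `J` is well defined. -/
def HarrisonIntegrable [CompleteSpace F] {r : ℕ} (J : Chain r V) (ω : ℂ → V →L[ℝ] F) : Prop :=
  ∃ I, HasHarrisonIntegral J ω I

open scoped Classical in
/-- The Harrison integral `⨍_J ω`, with the value `0` where it is not well defined. -/
def harrisonIntegral [CompleteSpace F] {r : ℕ} (J : Chain r V) (ω : ℂ → V →L[ℝ] F) : F :=
  if h : HarrisonIntegrable J ω then h.choose else 0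

/-- The complex-valued `1`-form `g(w) dw` on `ℝ² = ℂ`. With `g = a + i b` it is
`(a dx - b dy) + i (b dx + a dy)`. -/
def holForm (g : ℂ → ℂ) : ℂ → ℂ →L[ℝ] ℂ := fun w => g w • ContinuousLinearMap.id ℝ ℂ

/-- The generalized winding number `Ind_J(z) = (1/2πi) ⨍_J dw/(w - z)`. -/
def windingNumber {r : ℕ} (J : Chain r ℂ) (z : ℂ) : ℂ :=
  1 / (2 * Real.pi * Complex.I) * harrisonIntegral J (holForm fun w => 1 / (w - z))

end DiffChain

end

/-! On `U` write f(w)/(w - z) = f(z)/(w - z) + F(w), where F is the difference quotient of f at z,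
with the value f'(z) at z. By removability of singularities F is holomorphic on all of `U`, so the
formula reduces to Cauchy's theorem: F dw integrates to 0 over the closed chain `J`.

Cauchy's theorem follows from Stokes. Contractibility gives F a primitive G near `supp J`
(`exists_primitive_of_contractible`, by continuation along the contraction). After multiplying G by
a cutoff, F dw is dG near `supp J`, and the integral of dG over `J` is that of G over `boundary J`,
which is 0 (`integralB_boundary`). Stokes itself is the duality of prederivative with directional
derivative and of retraction with the inner product, checked on pointed chains and extended by
density.

Well-definedness has two halves. Since `U` is bounded, `supp J` is compact, and a cutoff turns a
form that is smooth near it into a compactly supported smooth form, which lies in every B^r space.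
Independence of the extension is `integralB_eq_zero`. The subtlety there is that `supp J` is only an
intersection of supporting sets and is not known to support `J` itself; compactness of a cutoff and
a partition of unity reduce the claim to finitely many supporting sets, and rescaled cutoffs then
remove the compactness. -/

noncomputable section

namespace DiffChain

open scoped ContDiff

/-! ### Functions on the plane with bounded iterated differences. -/

section BoundedDifferences

variable {E E' : Type*} [NormedAddCommGroup E] [NormedAddCommGroup E']

/-- The iterated difference of a function, dual to `iterDifference`. -/
def iterDiff : List ℂ → (ℂ → E) → ℂ → E
  | [], g => g
  | u :: U, g => iterDiff U fun p => g (p + u) - g p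

/-- The iterated differences of `g` of order at most `r` are bounded by `C` times the product of
the lengths of the steps. -/
def DiffBound (r : ℕ) (C : ℝ) (g : ℂ → E) : Prop :=
  ∀ U : List ℂ, U.length ≤ r → ∀ p, ‖iterDiff U g p‖ ≤ C * (U.map (‖·‖)).prod

lemma iterDiff_add (U : List ℂ) (g h : ℂ → E) :
    iterDiff U (g + h) = iterDiff U g + iterDiff U h := by
  induction U generalizing g h with
  | nil => rfl
  | cons u U ih =>
    simp only [iterDiff]
    rw [← ih]
    congr 1
    funext p
    simp only [Pi.add_apply]
    abel

lemma iterDiff_sub (U : List ℂ) (g h : ℂ → E) :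
    iterDiff U (g - h) = iterDiff U g - iterDiff U h := by
  rw [eq_sub_iff_add_eq, ← iterDiff_add, sub_add_cancel]

lemma iterDiff_comp_add (U : List ℂ) (g : ℂ → E) (u p : ℂ) :
    iterDiff U (fun q => g (q + u)) p = iterDiff U g (p + u) := by
  induction U generalizing g with
  | nil => rfl
  | cons v U ih =>
    simp only [iterDiff]
    rw [← ih fun p => g (p + v) - g p]
    simp only [add_right_comm]

lemma DiffBound.nonneg {r : ℕ} {C : ℝ} {g : ℂ → E} (h : DiffBound r C g) : 0 ≤ C := by
  simpa using (norm_nonneg _).trans (h [] (Nat.zero_le r) 0)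

lemma DiffBound.mono {r s : ℕ} {C D : ℝ} {g : ℂ → E} (h : DiffBound r C g) (hs : s ≤ r)
    (hC : C ≤ D) : DiffBound s D g := fun U hU p =>
  (h U (hU.trans hs) p).trans
    (mul_le_mul_of_nonneg_right hC (List.prod_nonneg (by simp)))

lemma DiffBound.add {r : ℕ} {C D : ℝ} {g h : ℂ → E} (hg : DiffBound r C g)
    (hh : DiffBound r D h) : DiffBound r (C + D) (g + h) := fun U hU p => by
  rw [iterDiff_add, add_mul]
  exact (norm_add_le _ _).trans (add_le_add (hg U hU p) (hh U hU p))

lemma DiffBound.comp_add {r : ℕ} {C : ℝ} {g : ℂ → E} (h : DiffBound r C g) (u : ℂ) :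
    DiffBound r C fun p => g (p + u) := fun U hU p => by
  rw [iterDiff_comp_add]
  exact h U hU _

lemma DiffBound.difference {r : ℕ} {C : ℝ} {g : ℂ → E} (h : DiffBound (r + 1) C g) (u : ℂ) :
    DiffBound r (C * ‖u‖) fun p => g (p + u) - g p := fun U hU p => by
  have := h (u :: U) (by simpa using hU) p
  rwa [List.map_cons, List.prod_cons, ← mul_assoc] at this

lemma iterDiff_comp_smul (c : ℝ) (U : List ℂ) (g : ℂ → E) (p : ℂ) :
    iterDiff U (fun q => g (c • q)) p = iterDiff (U.map (c • ·)) g (c • p) := by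
  induction U generalizing g with
  | nil => rfl
  | cons u U ih =>
    simp only [iterDiff, List.map_cons]
    rw [← ih fun p => g (p + c • u) - g p]
    simp only [smul_add]

/-- Rescaling by `c ≤ 1` only shortens the steps, so the bound does not depend on `c`. This makes
the dilates of one cutoff uniformly bounded. -/
lemma DiffBound.comp_smul {r : ℕ} {C : ℝ} {g : ℂ → E} (h : DiffBound r C g) {c : ℝ}
    (hc0 : 0 ≤ c) (hc1 : c ≤ 1) : DiffBound r C fun p => g (c • p) := fun U hU p => by
  rw [iterDiff_comp_smul]
  refine (h _ (by simpa using hU) _).trans ?_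
  refine mul_le_mul_of_nonneg_left ?_ h.nonneg
  clear hU
  induction U with
  | nil => simp
  | cons u U ih =>
    simp only [List.map_cons, List.prod_cons]
    refine mul_le_mul ?_ ih (List.prod_nonneg (by simp; intros; positivity)) (norm_nonneg u)
    rw [norm_smul, Real.norm_of_nonneg hc0]
    exact mul_le_of_le_one_left (norm_nonneg u) hc1

lemma diffBound_const (r : ℕ) (c : E) : DiffBound r ‖c‖ fun _ => c := by
  have h0 : ∀ U : List ℂ, iterDiff U (fun _ => (0 : E)) = fun _ => 0 := by
    intro U
    induction U with
    | nil => rfl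
    | cons u U ih => simpa [iterDiff] using ih
  rintro (_ | ⟨u, U⟩) - p
  · simp [iterDiff]
  · simp only [iterDiff, sub_self, h0, norm_zero]
    exact mul_nonneg (norm_nonneg c) (List.prod_nonneg (by simp))

variable [NormedSpace ℝ E] [NormedSpace ℝ E']

/-- The Leibniz rule for differences. -/
lemma DiffBound.smul {r : ℕ} {C D : ℝ} {φ : ℂ → ℝ} {g : ℂ → E} (hφ : DiffBound r C φ)
    (hg : DiffBound r D g) : DiffBound r (2 ^ r * (C * D)) fun p => φ p • g p := by
  induction r generalizing C D φ g with
  | zero =>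
    intro U hU p
    obtain rfl : U = [] := by simpa using hU
    have h1 := hφ [] le_rfl p
    have h2 := hg [] le_rfl p
    simp only [iterDiff, List.map_nil, List.prod_nil, mul_one] at h1 h2 ⊢
    rw [norm_smul, pow_zero, one_mul]
    exact mul_le_mul h1 h2 (norm_nonneg _) hφ.nonneg
  | succ r ih =>
    have hC := hφ.nonneg
    have hD := hg.nonneg
    have hlow := ih (hφ.mono r.le_succ le_rfl) (hg.mono r.le_succ le_rfl)
    rintro (_ | ⟨u, U⟩) hU p
    · refine (hlow [] (Nat.zero_le r) p).trans ?_
      gcongr <;> norm_num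
    -- Δ(φg)(p) = φ(p + u)·Δg(p) + Δφ(p)·g(p). Each of the two terms costs 2^r · C · D · ‖u‖, hence
    -- the factor 2 per order.
    · have h1 := ih ((hφ.comp_add u).mono r.le_succ le_rfl) (hg.difference u)
      have h2 := ih (hφ.difference u) (hg.mono r.le_succ le_rfl)
      have h := (h1.add h2) U (by simpa using hU) p
      simp only [iterDiff, List.map_cons, List.prod_cons]
      refine (le_of_eq ?_).trans (h.trans (le_of_eq ?_))
      · congr 2
        funext q
        simp only [Pi.add_apply, smul_sub, sub_smul]
        abel
      · ring

lemma DiffBound.clm_comp {r : ℕ} {C : ℝ} {g : ℂ → E} (h : DiffBound r C g) (T : E →L[ℝ] E') :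
    DiffBound r (‖T‖ * C) fun p => T (g p) := fun U hU p => by
  have : ∀ (U : List ℂ) (g : ℂ → E), iterDiff U (fun q => T (g q)) p = T (iterDiff U g p) := by
    intro U
    induction U with
    | nil => intro g; rfl
    | cons u U ih =>
      intro g
      simp only [iterDiff, ← map_sub]
      exact ih _
  rw [this, mul_assoc]
  exact (T.le_opNorm _).trans (mul_le_mul_of_nonneg_left (h U hU p) (norm_nonneg T))

lemma contDiff_iterDiff {n : WithTop ℕ∞} (U : List ℂ) {g : ℂ → E} (hg : ContDiff ℝ n g) :
    ContDiff ℝ n (iterDiff U g) := by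
  induction U generalizing g with
  | nil => exact hg
  | cons u U ih => exact ih (by fun_prop)

lemma fderiv_iterDiff (U : List ℂ) {g : ℂ → E} (hg : Differentiable ℝ g) (p : ℂ) :
    fderiv ℝ (iterDiff U g) p = iterDiff U (fderiv ℝ g) p := by
  induction U generalizing g with
  | nil => rfl
  | cons u U ih =>
    simp only [iterDiff]
    rw [ih (by fun_prop)]
    congr 1
    funext q
    rw [fderiv_fun_sub (by fun_prop) (by fun_prop), fderiv_comp_add_right]

/-- One difference is bounded through the mean value inequality by the derivative, which commutes
with the remaining differences. The induction passes from `g` to `fderiv ℝ g`, whose values lie in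
another space, so `E` is quantified inside the statement. -/
lemma norm_iterDiff_le_of_hasCompactSupport (n : ℕ) : ∀ {E : Type _} [NormedAddCommGroup E]
    [NormedSpace ℝ E] {g : ℂ → E}, ContDiff ℝ ∞ g → HasCompactSupport g →
    ∃ C, 0 ≤ C ∧ ∀ U : List ℂ, U.length = n → ∀ p, ‖iterDiff U g p‖ ≤ C * (U.map (‖·‖)).prod := by
  induction n with
  | zero =>
    intro E _ _ g hg hc
    obtain ⟨C, hC⟩ := hc.exists_bound_of_continuous hg.continuous
    refine ⟨C, (norm_nonneg _).trans (hC 0), fun U hU p => ?_⟩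
    obtain rfl : U = [] := by simpa using hU
    simpa [iterDiff] using hC p
  | succ n ih =>
    intro E _ _ g hg hc
    obtain ⟨C, hC0, hC⟩ := ih (hg.fderiv_right (m := ∞) (by simp)) (hc.fderiv ℝ)
    refine ⟨C, hC0, ?_⟩
    rintro (_ | ⟨u, U⟩) hU p
    · simp at hU
    have hd : Differentiable ℝ (iterDiff U g) :=
      (contDiff_iterDiff U hg).differentiable (by simp)
    have hb : ∀ q ∈ Set.univ, ‖fderiv ℝ (iterDiff U g) q‖ ≤ C * (U.map (‖·‖)).prod := by
      intro q _
      rw [fderiv_iterDiff U (hg.differentiable (by simp))]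
      exact hC U (by simpa using hU) q
    have hm := convex_univ.norm_image_sub_le_of_norm_fderiv_le (fun q _ => hd q) hb
      (Set.mem_univ p) (Set.mem_univ (p + u))
    have e : iterDiff (u :: U) g p = iterDiff U g (p + u) - iterDiff U g p := by
      rw [← iterDiff_comp_add]
      exact congrFun (iterDiff_sub U (fun q => g (q + u)) g) p
    rw [e]
    refine hm.trans (le_of_eq ?_)
    rw [add_sub_cancel_left, List.map_cons, List.prod_cons]
    ring

/-- Smooth functions with compact support have bounded differences of every order. -/
lemma exists_diffBound_of_hasCompactSupport (r : ℕ) {g : ℂ → E} (hg : ContDiff ℝ ∞ g)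
    (hc : HasCompactSupport g) : ∃ C, DiffBound r C g := by
  choose C hC0 hC using fun n => norm_iterDiff_le_of_hasCompactSupport n hg hc
  refine ⟨∑ n ∈ Finset.range (r + 1), C n, fun U hU p => (hC _ U rfl p).trans ?_⟩
  refine mul_le_mul_of_nonneg_right ?_ (List.prod_nonneg (by simp))
  exact Finset.single_le_sum (f := C) (fun n _ => hC0 n) (Finset.mem_range.2 (by omega))

end BoundedDifferences

/-! ### Forms in B^r as functions with bounded differences; linearity of the integral. -/

section Integral

variable {V F F' : Type*} [NormedAddCommGroup V] [NormedSpace ℝ V]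
  [NormedAddCommGroup F] [NormedSpace ℝ F] [NormedAddCommGroup F'] [NormedSpace ℝ F']

lemma evalPointed_single (θ : ℂ → V →L[ℝ] F) (p : ℂ) (α : V) :
    evalPointed θ (Finsupp.single p α) = θ p α := by
  simp [evalPointed]

lemma evalPointed_eq_zero {θ : ℂ → V →L[ℝ] F} {A : PointedChain V}
    (h : ∀ p ∈ A.support, θ p = 0) : evalPointed θ A = 0 := by
  simp only [evalPointed, Finsupp.lsum_apply, Finsupp.sum]
  exact Finset.sum_eq_zero fun p hp => by rw [h p hp]; rfl

lemma evalPointed_difference (θ : ℂ → V →L[ℝ] F) (u : ℂ) (A : PointedChain V) :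
    evalPointed θ (difference u A) = evalPointed (fun p => θ (p + u) - θ p) A := by
  induction A using Finsupp.induction_linear with
  | zero => simp
  | add A B hA hB => simp only [map_add, hA, hB]
  | single p α => rw [difference_single, map_sub]; simp only [evalPointed_single]; rfl

/-- Differences move from the chain to the form. This identifies B^r with the operator-valued
functions satisfying `DiffBound r`. -/
lemma evalPointed_differenceChain (θ : ℂ → V →L[ℝ] F) (d : List ℂ × ℂ × V) :
    evalPointed θ (differenceChain d) = iterDiff d.1 θ d.2.1 d.2.2 := by
  obtain ⟨U, p, α⟩ := d
  induction U generalizing θ with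
  | nil => exact evalPointed_single θ p α
  | cons u U ih =>
    simp only [differenceChain, iterDifference, LinearMap.comp_apply] at ih ⊢
    rw [evalPointed_difference, ih]
    rfl

lemma DiffBound.norm_evalPointed_le {r : ℕ} {C : ℝ} {θ : ℂ → V →L[ℝ] F} (h : DiffBound r C θ)
    (d : List ℂ × ℂ × V) (hd : d.1.length ≤ r) :
    ‖evalPointed θ (differenceChain d)‖ ≤ C * weight d := by
  rw [evalPointed_differenceChain, weight, ← mul_assoc]
  exact (ContinuousLinearMap.le_opNorm _ _).trans
    (mul_le_mul_of_nonneg_right (h d.1 hd d.2.1) (norm_nonneg _))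

lemma DiffBound.isBForm {r : ℕ} {C : ℝ} {θ : ℂ → V →L[ℝ] F} (h : DiffBound r C θ) :
    IsBForm r θ :=
  ⟨C, fun d hd hw => by simpa [hw] using h.norm_evalPointed_le d hd⟩

lemma DiffBound.norm_integralB_le [CompleteSpace F] {r : ℕ} {C : ℝ} {θ : ℂ → V →L[ℝ] F}
    (h : DiffBound r C θ) (J : Chain r V) : ‖integralB θ J‖ ≤ C * ‖J‖ :=
  norm_extend_le h.nonneg h.norm_evalPointed_le J

/-- `IsBForm` tests only chains of weight 1. Rescaling the vector handles every nonzero weight, and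
a difference chain of weight 0 is itself 0. -/
lemma IsBForm.exists_diffBound {r : ℕ} {θ : ℂ → V →L[ℝ] F} (hθ : IsBForm r θ) :
    ∃ C, DiffBound r C θ := by
  obtain ⟨C, hC⟩ := hθ
  refine ⟨max C 0, fun U hU p => ContinuousLinearMap.opNorm_le_bound _
    (mul_nonneg (le_max_right _ _) (List.prod_nonneg (by simp))) fun α => ?_⟩
  have hC0 : 0 ≤ max C 0 := le_max_right _ _
  have hU0 : 0 ≤ (U.map (‖·‖)).prod := List.prod_nonneg (by simp)
  have hev := evalPointed_differenceChain θ (U, p, α)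
  simp only at hev
  rw [← hev]
  rcases eq_or_ne (weight (U, p, α)) 0 with h | h
  · rw [differenceChain_eq_zero _ h, map_zero, norm_zero]
    positivity
  · have hw : weight (U, p, (weight (U, p, α))⁻¹ • α) = 1 := by
      have h0 := weight_nonneg (U, p, α)
      have : weight (U, p, (weight (U, p, α))⁻¹ • α) =
          (weight (U, p, α))⁻¹ * weight (U, p, α) := by
        conv_lhs => rw [weight]
        simp only [norm_smul, norm_inv, Real.norm_eq_abs, abs_of_nonneg h0]
        simp only [weight]
        ring
      rw [this, inv_mul_cancel₀ h]
    have h1 := hC _ hU hw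
    rw [evalPointed_differenceChain, map_smul, norm_smul, norm_inv,
      Real.norm_of_nonneg (weight_nonneg _),
      inv_mul_le_iff₀ ((weight_nonneg _).lt_of_ne' h)] at h1
    rw [hev]
    refine h1.trans ?_
    rw [mul_assoc, mul_comm]
    exact mul_le_mul_of_nonneg_right (le_max_left C 0) (weight_nonneg _)

lemma isBForm_of_hasCompactSupport (r : ℕ) {θ : ℂ → V →L[ℝ] F} (hθ : ContDiff ℝ ∞ θ)
    (hc : HasCompactSupport θ) : IsBForm r θ :=
  (exists_diffBound_of_hasCompactSupport r hθ hc).choose_spec.isBForm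

lemma IsBForm.add {r : ℕ} {θ η : ℂ → V →L[ℝ] F} (hθ : IsBForm r θ) (hη : IsBForm r η) :
    IsBForm r (θ + η) :=
  (hθ.exists_diffBound.choose_spec.add hη.exists_diffBound.choose_spec).isBForm

lemma IsBForm.clm_comp {r : ℕ} {θ : ℂ → V →L[ℝ] F} (hθ : IsBForm r θ)
    {V' : Type*} [NormedAddCommGroup V'] [NormedSpace ℝ V']
    (T : (V →L[ℝ] F) →L[ℝ] (V' →L[ℝ] F')) : IsBForm r fun p => T (θ p) :=
  (hθ.exists_diffBound.choose_spec.clm_comp T).isBForm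

lemma IsBForm.neg {r : ℕ} {θ : ℂ → V →L[ℝ] F} (hθ : IsBForm r θ) : IsBForm r (-θ) :=
  hθ.clm_comp (-ContinuousLinearMap.id ℝ (V →L[ℝ] F))

variable [CompleteSpace F]

lemma continuous_integralB {r : ℕ} (θ : ℂ → V →L[ℝ] F) :
    Continuous (integralB θ : Chain r V → F) :=
  (extend r (evalPointed θ)).continuous

lemma integralB_add {r : ℕ} {θ η : ℂ → V →L[ℝ] F} (hθ : IsBForm r θ) (hη : IsBForm r η)
    (J : Chain r V) : integralB (θ + η) J = integralB θ J + integralB η J := by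
  refine (denseRange_ofPointed r).induction_on J ?_ fun A => ?_
  · exact isClosed_eq (continuous_integralB _)
      ((continuous_integralB θ).add (continuous_integralB η))
  · rw [integralB_ofPointed (hθ.add hη), integralB_ofPointed hθ, integralB_ofPointed hη]
    induction A using Finsupp.induction_linear with
    | zero => simp
    | add A B hA hB => simp only [map_add, hA, hB]; abel
    | single p α => simp [evalPointed_single]

lemma integralB_sub {r : ℕ} {θ η : ℂ → V →L[ℝ] F} (hθ : IsBForm r θ) (hη : IsBForm r η)
    (J : Chain r V) : integralB (θ - η) J = integralB θ J - integralB η J := by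
  have h : IsBForm r (θ - η) := by rw [sub_eq_add_neg]; exact hθ.add hη.neg
  rw [eq_sub_iff_add_eq, ← integralB_add h hη, sub_add_cancel]

lemma integralB_zero {r : ℕ} (J : Chain r V) :
    integralB (fun _ => 0 : ℂ → V →L[ℝ] F) J = 0 := by
  have h := (diffBound_const r (0 : V →L[ℝ] F)).norm_integralB_le J
  simpa using h

end Integral

/-! ### Forms vanishing near the support integrate to zero. -/

section Support

open Manifold in
/-- A smooth compactly supported function which is `1` near a given compact set and supported in a
given neighbourhood of it. -/
lemma exists_cutoff {K O : Set ℂ} (hK : IsCompact K) (hO : IsOpen O) (hKO : K ⊆ O) :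
    ∃ χ : ℂ → ℝ, ContDiff ℝ ∞ χ ∧ HasCompactSupport χ ∧ tsupport χ ⊆ O ∧
      ∀ᶠ w in 𝓝ˢ K, χ w = 1 := by
  obtain ⟨L, hL, hKL, hLO⟩ := exists_compact_between hK hO hKO
  obtain ⟨χ, h1, h0, -⟩ := exists_contMDiffMap_one_nhds_of_subset_interior (n := (⊤ : ℕ∞)) 𝓘(ℝ, ℂ)
    hK.isClosed hKL
  have hs : tsupport χ ⊆ L := closure_minimal
    (fun x hx => by_contra fun hxL => hx (h0 x hxL)) hL.isClosed
  exact ⟨χ, χ.contMDiff.contDiff, HasCompactSupport.of_support_subset_isCompact hL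
    ((subset_tsupport _).trans hs), hs.trans hLO, h1⟩

variable {V F : Type*} [NormedAddCommGroup V] [NormedSpace ℝ V]
  [NormedAddCommGroup F] [NormedSpace ℝ F]

lemma IsBForm.smul {r : ℕ} {φ : ℂ → ℝ} {η : ℂ → V →L[ℝ] F} (hη : IsBForm r η)
    (hφ : ContDiff ℝ ∞ φ) (hc : HasCompactSupport φ) : IsBForm r fun p => φ p • η p :=
  ((exists_diffBound_of_hasCompactSupport r hφ hc).choose_spec.smul
    hη.exists_diffBound.choose_spec).isBForm

variable [CompleteSpace F]

/-- `J` is a limit of pointed chains in `W`, and the form evaluates to 0 on each of them. -/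
lemma integralB_eq_zero_of_isSupportedBy {r : ℕ} {J : Chain r V} {X W : Set ℂ}
    (hX : IsSupportedBy J X) {η : ℂ → V →L[ℝ] F} (hη : IsBForm r η) (hW : IsOpen W)
    (hne : W.Nonempty) (hXW : X ⊆ W) (h : ∀ w ∈ W, η w = 0) : integralB η J = 0 := by
  obtain ⟨A, hA, hlim⟩ := hX.2 W hW hne hXW
  refine tendsto_nhds_unique (((continuous_integralB η).tendsto J).comp hlim) ?_
  refine tendsto_const_nhds.congr fun i => ?_
  rw [Function.comp_apply, integralB_ofPointed hη, evalPointed_eq_zero fun p hp => h p (hA i hp)]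

lemma integralB_sum {r : ℕ} {ι : Type*} (s : Finset ι) {η : ι → ℂ → V →L[ℝ] F}
    (hη : ∀ i ∈ s, IsBForm r (η i)) (J : Chain r V) :
    IsBForm r (fun p => ∑ i ∈ s, η i p) ∧
      integralB (fun p => ∑ i ∈ s, η i p) J = ∑ i ∈ s, integralB (η i) J := by
  classical
  induction s using Finset.induction_on with
  | empty => simpa [integralB_zero] using (diffBound_const r (0 : V →L[ℝ] F)).isBForm
  | insert a s ha ih =>
    have h1 := hη a (by simp)
    have h2 := ih fun i hi => hη i (by simp [hi])
    have e : (fun p => ∑ i ∈ insert a s, η i p) = η a + fun p => ∑ i ∈ s, η i p := by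
      funext p
      simp [Finset.sum_insert ha]
    rw [e, Finset.sum_insert ha, integralB_add h1 h2.1, h2.2]
    exact ⟨h1.add h2.1, rfl⟩

open Manifold in
/-- The integral of a compactly supported form that vanishes near the support of the chain. -/
lemma integralB_smul_eq_zero {r : ℕ} {J : Chain r V} {η : ℂ → V →L[ℝ] F} (hη : IsBForm r η)
    {O : Set ℂ} (hO : IsOpen O) (hJO : supp J ⊆ O) (h0 : ∀ w ∈ O, η w = 0)
    {φ : ℂ → ℝ} (hφ : ContDiff ℝ ∞ φ) (hc : HasCompactSupport φ) :
    integralB (fun p => φ p • η p) J = 0 := by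
  -- A point outside `supp J` misses some supporting set, so `O` (index `none`) and the complements
  -- of the supporting sets cover the plane. Finitely many suffice on the compact `tsupport φ`.
  let c : Option {X // IsSupportedBy J X} → Set ℂ := fun i => i.elim O fun X => (X : Set ℂ)ᶜ
  have hco : ∀ i, IsOpen (c i) := by
    rintro (_ | X)
    · exact hO
    · exact X.2.1.isOpen_compl
  have hcov : tsupport φ ⊆ ⋃ i, c i := by
    intro w _
    by_cases hw : w ∈ supp J
    · exact Set.mem_iUnion.2 ⟨none, hJO hw⟩
    · simp only [supp, Set.mem_sInter, not_forall] at hw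
      obtain ⟨X, hX, hwX⟩ := hw
      exact Set.mem_iUnion.2 ⟨some ⟨X, hX⟩, hwX⟩
  obtain ⟨t, ht⟩ := hc.isCompact.elim_finite_subcover c hco hcov
  obtain ⟨ρ, hρ⟩ := SmoothPartitionOfUnity.exists_isSubordinate 𝓘(ℝ, ℂ) (isClosed_tsupport φ)
    (fun i : t => c i) (fun i => hco i) fun x hx => by
      obtain ⟨i, hi, hxi⟩ := Set.mem_iUnion₂.1 (ht hx)
      exact Set.mem_iUnion.2 ⟨⟨i, hi⟩, hxi⟩
  have hρs : ∀ i, ContDiff ℝ ∞ (fun p => ρ i p * φ p) := fun i =>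
    (ρ i).contMDiff.contDiff.mul hφ
  have hρc : ∀ i, HasCompactSupport (fun p => ρ i p * φ p) := fun i => hc.mul_left
  have hsum : (fun p => φ p • η p) = fun p => ∑ i, (ρ i p * φ p) • η p := by
    funext p
    rw [← Finset.sum_smul, ← Finset.sum_mul]
    by_cases hp : p ∈ tsupport φ
    · rw [← finsum_eq_sum_of_fintype, ρ.sum_eq_one hp, one_mul]
    · rw [image_eq_zero_of_notMem_tsupport hp, mul_zero]
  rw [hsum, (integralB_sum _ (fun i _ => hη.smul (hρs i) (hρc i)) J).2]
  refine Finset.sum_eq_zero fun i _ => ?_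
  have hi := hρ i
  obtain ⟨(_ | X), hit⟩ := i
  · have : (fun p => (ρ ⟨none, hit⟩ p * φ p) • η p) = fun _ => 0 := by
      funext p
      by_cases hp : p ∈ O
      · rw [h0 p hp, smul_zero]
      · rw [image_eq_zero_of_notMem_tsupport fun hp' => hp (hi hp'), zero_mul, zero_smul]
    rw [this, integralB_zero]
  -- This piece vanishes off a compact set disjoint from `X`. The complement of that set serves as
  -- `W`; it is nonempty because the plane is not compact.
  · have hcs := (hρc ⟨some X, hit⟩).isCompact
    refine integralB_eq_zero_of_isSupportedBy X.2 (hη.smul (hρs _) (hρc _))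
      (isClosed_tsupport _).isOpen_compl
      (Set.nonempty_compl.2 fun hu => noncompact_univ ℂ (hu ▸ hcs)) (fun x hx hx' => ?_)
      fun w hw => by rw [image_eq_zero_of_notMem_tsupport hw, zero_smul]
    exact hi (closure_mono (Function.support_mul_subset_left _ _) hx') hx

/-- A form that vanishes near the support of a chain has integral `0` over it. -/
lemma integralB_eq_zero {r : ℕ} {J : Chain r V} {η : ℂ → V →L[ℝ] F} (hη : IsBForm r η)
    (h0 : ∀ᶠ w in 𝓝ˢ (supp J), η w = 0) : integralB η J = 0 := by
  obtain ⟨O, hO, hJO, hz⟩ := eventually_nhdsSet_iff_exists.1 h0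
  obtain ⟨χ, hχ, hχc, -, hχ1⟩ := exists_cutoff (isCompact_singleton (x := (0 : ℂ))) isOpen_univ
    (Set.subset_univ _)
  rw [nhdsSet_singleton] at hχ1
  obtain ⟨C, hC⟩ := exists_diffBound_of_hasCompactSupport r hχ hχc
  obtain ⟨D, hD⟩ := hη.exists_diffBound
  have hC0 := hC.nonneg
  have hD0 := hD.nonneg
  -- A bound for the form η - χ(c·)η, valid for every `c` in (0, 1].
  set M := D + 2 ^ r * (C * D) with hM
  have hM0 : 0 ≤ M := by positivity
  -- For small `c` the dilated cutoff is 1 on the finite support of `A`, so η - χ(c·)η vanishes on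
  -- `A`. Its integral over `J` is that of `η`, since the compactly supported part χ(c·)η integrates
  -- to 0. As `M` is independent of `A`, density finishes the proof.
  have key : ∀ (A : PointedChain V), ‖integralB η J‖ ≤ M * ‖J - ofPointed r A‖ := by
    intro A
    have hev : ∀ᶠ c in 𝓝[>] (0 : ℝ), ∀ p ∈ A.support, χ (c • p) = 1 := by
      rw [Filter.eventually_all_finset]
      intro p _
      have : Tendsto (fun c : ℝ => c • p) (𝓝[>] 0) (𝓝 0) := by
        have h : Tendsto (fun c : ℝ => c • p) (𝓝 0) (𝓝 ((0 : ℝ) • p)) :=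
          (continuous_id.smul continuous_const).tendsto 0
        rw [zero_smul] at h
        exact h.mono_left nhdsWithin_le_nhds
      exact this.eventually hχ1
    obtain ⟨c, hcA, hc1, hc0⟩ := (hev.and ((eventually_nhdsWithin_of_eventually_nhds
      (eventually_le_nhds zero_lt_one)).and self_mem_nhdsWithin)).exists
    have hc0 : 0 < c := hc0
    have hχs : ContDiff ℝ ∞ fun p : ℂ => χ (c • p) := hχ.comp (contDiff_const_smul c)
    have hχcs : HasCompactSupport fun p : ℂ => χ (c • p) := by
      exact hχc.comp_homeomorph (Homeomorph.smulOfNeZero c hc0.ne')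
    have hB := (hC.comp_smul hc0.le hc1).smul hD
    have hE : DiffBound r M (η + -fun p => χ (c • p) • η p) := by
      refine hD.add fun U hU p => ?_
      have h := hB U hU p
      rw [← zero_sub, iterDiff_sub]
      have h00 := diffBound_const r (0 : V →L[ℝ] F) U hU p
      rw [norm_zero, zero_mul] at h00
      have h00 : iterDiff U (0 : ℂ → V →L[ℝ] F) p = 0 := norm_le_zero_iff.1 h00
      rwa [Pi.sub_apply, h00, zero_sub, norm_neg]
    have e1 : integralB (η + -fun p => χ (c • p) • η p) J = integralB η J := by
      rw [← sub_eq_add_neg, integralB_sub hη hB.isBForm,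
        integralB_smul_eq_zero hη hO hJO hz hχs hχcs, sub_zero]
    have e2 : integralB (η + -fun p => χ (c • p) • η p) (ofPointed r A) = 0 := by
      rw [integralB_ofPointed hE.isBForm]
      refine evalPointed_eq_zero fun p hp => ?_
      rw [Pi.add_apply, Pi.neg_apply, hcA p hp, one_smul, add_neg_cancel]
    have e3 := hE.norm_integralB_le (J - ofPointed r A)
    simp only [integralB, map_sub] at e1 e2 e3 ⊢
    rwa [e1, e2, sub_zero] at e3
  refine norm_le_zero_iff.1 (le_of_forall_pos_le_add fun ε hε => ?_)
  obtain ⟨A, hA⟩ := Metric.denseRange_iff.1 (denseRange_ofPointed (V := V) r) J (ε / (M + 1))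
    (by positivity)
  rw [dist_eq_norm, lt_div_iff₀ (by positivity)] at hA
  have := norm_nonneg (J - ofPointed r A)
  linarith [key A]

/-- The integral near the support does not depend on the extension. -/
lemma IsExtensionNear.hasHarrisonIntegral {r : ℕ} {J : Chain r V} {θ η : ℂ → V →L[ℝ] F}
    (h : IsExtensionNear J θ η) : HasHarrisonIntegral J θ (integralB η J) := by
  refine ⟨⟨η, h⟩, fun η' h' => ?_⟩
  rw [← sub_eq_zero, ← integralB_sub h'.1 h.1]
  have hb : IsBForm r (η' - η) := by rw [sub_eq_add_neg]; exact h'.1.add h.1.neg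
  refine integralB_eq_zero hb ?_
  filter_upwards [h.2, h'.2] with w h1 h2
  rw [Pi.sub_apply, h1, h2, sub_self]

lemma IsExtensionNear.harrisonIntegral_eq {r : ℕ} {J : Chain r V} {θ η : ℂ → V →L[ℝ] F}
    (h : IsExtensionNear J θ η) : harrisonIntegral J θ = integralB η J := by
  have hi : HarrisonIntegrable J θ := ⟨_, h.hasHarrisonIntegral⟩
  rw [harrisonIntegral, dif_pos hi]
  exact (hi.choose_spec.2 η h).symm

end Support

/-! ### Stokes' theorem. -/

section Boundary

variable {V F : Type*} [NormedAddCommGroup V] [NormedSpace ℝ V]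
  [NormedAddCommGroup F] [NormedSpace ℝ F]

/-- The function `g` as a `0`-form. -/
def zeroForm (g : ℂ → F) : ℂ → ℝ →L[ℝ] F := fun p => (ContinuousLinearMap.id ℝ ℝ).smulRight (g p)

lemma evalPointed_zeroForm_mapFibre (g : ℂ → ℂ →L[ℝ] F) (T : ℂ →L[ℝ] ℝ) (v : ℂ)
    (A : PointedChain ℂ) :
    evalPointed (zeroForm fun p => g p v) (mapFibre T A) =
      evalPointed (fun p => T.smulRight (g p v)) A := by
  induction A using Finsupp.induction_linear with
  | zero => simp
  | add A B hA hB => simp only [map_add, hA, hB]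
  | single p α => simp [mapFibre, evalPointed_single, zeroForm]

lemma isBForm_zeroForm (r : ℕ) {g : ℂ → F} (hg : ContDiff ℝ ∞ g) (hc : HasCompactSupport g) :
    IsBForm r (zeroForm g) :=
  isBForm_of_hasCompactSupport r (contDiff_const.smulRight hg)
    (hc.comp_left (g := fun y => (ContinuousLinearMap.id ℝ ℝ).smulRight y) (by ext; simp))

/-- Duality of prederivative and directional derivative on pointed chains: at a single point this is
the derivative of `g` along a line. -/
lemma tendsto_evalPointed_difference {g : ℂ → F} (hg : Differentiable ℝ g) (v : ℂ)
    (A : PointedChain ℝ) :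
    Tendsto (fun t : ℝ => evalPointed (zeroForm g) (t⁻¹ • difference (t • v) A)) (𝓝[≠] 0)
      (𝓝 (evalPointed (zeroForm fun p => fderiv ℝ g p v) A)) := by
  induction A using Finsupp.induction_linear with
  | zero => simp
  | add A B hA hB => simpa only [map_add, smul_add] using hA.add hB
  | single p a =>
    have h : HasDerivAt (fun t : ℝ => g (p + t • v)) (fderiv ℝ g p v) 0 := by
      have h1 : HasDerivAt (fun t : ℝ => p + t • v) ((1 : ℝ) • v) 0 :=
        ((hasDerivAt_id (0 : ℝ)).smul_const v).const_add p
      rw [one_smul] at h1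
      have h2 : HasFDerivAt g (fderiv ℝ g p) (p + (0 : ℝ) • v) := by
        simpa using (hg p).hasFDerivAt
      exact h2.comp_hasDerivAt (0 : ℝ) h1
    have h3 := (hasDerivAt_iff_tendsto_slope.1 h).const_smul a
    have hz : ∀ (k : ℂ → F) (q : ℂ), evalPointed (zeroForm k) (Finsupp.single q a) = a • k q := by
      intro k q
      simp [evalPointed_single, zeroForm]
    rw [hz]
    refine h3.congr fun t => ?_
    rw [map_smul, difference_single, map_sub, hz, hz, slope_def_module, sub_zero, zero_smul,
      add_zero, ← smul_sub, smul_comm]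

variable [CompleteSpace F]

/-- The prederivative is dual to the directional derivative. -/
lemma integralB_prederivative {r : ℕ} (hr : 1 ≤ r) {g : ℂ → F} (hg : ContDiff ℝ ∞ g)
    (hc : HasCompactSupport g) (v : ℂ) (K : Chain r ℝ) :
    integralB (zeroForm g) (prederivative v K) =
      integralB (zeroForm fun p => fderiv ℝ g p v) K := by
  have hgB := isBForm_zeroForm (r + 1) hg hc
  have hdB : IsBForm r (zeroForm fun p => fderiv ℝ g p v) :=
    isBForm_zeroForm r ((hg.fderiv_right (m := ∞) (by simp)).clm_apply contDiff_const)
      (hc.fderiv_apply ℝ v)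
  have hlim : ∀ K : Chain r ℝ, Tendsto
      (fun t : ℝ => integralB (zeroForm g) (differenceQuotient v t K)) (𝓝[≠] 0)
      (𝓝 (integralB (zeroForm g) (prederivative v K))) := fun K =>
    ((continuous_integralB _).tendsto _).comp (tendsto_differenceQuotient hr v K)
  -- `prederivative` is a pointwise limit, so additivity comes from uniqueness of limits; with the
  -- uniform bound on difference quotients it yields the continuity that the density argument needs.
  have hadd : ∀ K L : Chain r ℝ, prederivative v (K + L) = prederivative v K + prederivative v L :=
    fun K L => tendsto_nhds_unique (tendsto_differenceQuotient hr v (K + L)) (by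
      simpa only [map_add] using
        (tendsto_differenceQuotient hr v K).add (tendsto_differenceQuotient hr v L))
  have hnorm : ∀ K : Chain r ℝ, ‖prederivative v K‖ ≤ ‖v‖ * ‖K‖ := fun K =>
    le_of_tendsto (tendsto_differenceQuotient hr v K).norm
      (Eventually.of_forall fun t => norm_differenceQuotient_le v t K)
  have hcont : Continuous (prederivative v : Chain r ℝ → Chain (r + 1) ℝ) :=
    AddMonoidHomClass.continuous_of_bound (AddMonoidHom.mk' _ hadd) ‖v‖ hnorm
  refine (denseRange_ofPointed r).induction_on K ?_ fun A => ?_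
  · exact isClosed_eq ((continuous_integralB _).comp hcont) (continuous_integralB _)
  · refine tendsto_nhds_unique (hlim _) ?_
    rw [integralB_ofPointed hdB]
    refine (tendsto_evalPointed_difference (hg.differentiable (by simp)) v A).congr fun t => ?_
    rw [differenceQuotient_ofPointed, integralB_ofPointed hgB]

/-- Stokes' theorem: the integral of `dg` over `J` is the integral of `g` over `∂J`. -/
theorem integralB_boundary {r : ℕ} (hr : 1 ≤ r) {g : ℂ → F} (hg : ContDiff ℝ ∞ g)
    (hc : HasCompactSupport g) (J : Chain r ℂ) :
    integralB (zeroForm g) (boundary J) = integralB (fderiv ℝ g) J := by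
  have hd : ContDiff ℝ ∞ (fderiv ℝ g) := hg.fderiv_right (m := ∞) (by simp)
  have hdc : HasCompactSupport (fderiv ℝ g) := hc.fderiv ℝ
  have hdB : IsBForm r (fderiv ℝ g) := isBForm_of_hasCompactSupport r hd hdc
  have hretr : ∀ v : ℂ, integralB (zeroForm g) (prederivative v (retraction v J)) =
      integralB (fun p => (innerSL ℝ v).smulRight (fderiv ℝ g p v)) J ∧
      IsBForm r (fun p => (innerSL ℝ v).smulRight (fderiv ℝ g p v)) := by
    intro v
    have hz : IsBForm r (zeroForm fun p => fderiv ℝ g p v) :=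
      isBForm_zeroForm r (hd.clm_apply contDiff_const) (hc.fderiv_apply ℝ v)
    have hB : IsBForm r (fun p => (innerSL ℝ v).smulRight (fderiv ℝ g p v)) :=
      isBForm_of_hasCompactSupport r
        (contDiff_const.smulRight (hd.clm_apply contDiff_const))
        ((hc.fderiv_apply ℝ v).comp_left (g := fun y => (innerSL ℝ v).smulRight y)
          (by ext; simp))
    refine ⟨?_, hB⟩
    rw [integralB_prederivative hr hg hc]
    refine (denseRange_ofPointed r).induction_on J ?_ fun A => ?_
    · exact isClosed_eq ((continuous_integralB _).comp (retraction v).continuous)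
        (continuous_integralB _)
    · rw [retraction_ofPointed, integralB_ofPointed hz, integralB_ofPointed hB,
        evalPointed_zeroForm_mapFibre]
  have hsplit : integralB (zeroForm g) (boundary J) =
      integralB (zeroForm g) (prederivative 1 (retraction 1 J)) +
        integralB (zeroForm g) (prederivative Complex.I (retraction Complex.I J)) :=
    map_add (extend (r + 1) (evalPointed (zeroForm g))) _ _
  rw [hsplit, (hretr 1).1, (hretr Complex.I).1, ← integralB_add (hretr 1).2 (hretr _).2]
  congr 1
  funext p
  ext x
  -- Pairing with 1 and i gives Re x and Im x, so the two retracted terms add up to dg(x).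
  have hx : x = x.re • (1 : ℂ) + x.im • Complex.I := by simp
  conv_rhs => rw [hx, map_add, map_smul, map_smul]
  simp

end Boundary

/-! ### Primitives by continuation along a contraction. -/

section Primitive

/-- The integral of `g` along the segment from `a` to `b`. -/
def segmentIntegral (g : ℂ → ℂ) (a b : ℂ) : ℂ :=
  ∫ t in (0 : ℝ)..1, (b - a) * g (a + t * (b - a))

lemma segmentIntegral_eq_sub {g P : ℂ → ℂ} {W : Set ℂ} (hW : Convex ℝ W)
    (hg : ContinuousOn g W) (hP : ∀ w ∈ W, HasDerivAt P (g w) w) {a b : ℂ} (ha : a ∈ W)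
    (hb : b ∈ W) : segmentIntegral g a b = P b - P a := by
  have hmem : ∀ t ∈ Set.uIcc (0 : ℝ) 1, a + (t : ℂ) * (b - a) ∈ W := by
    intro t ht
    rw [Set.uIcc_of_le zero_le_one] at ht
    simpa using hW.add_smul_sub_mem ha hb ht
  have hline : ∀ t : ℝ, HasDerivAt (fun t : ℝ => a + (t : ℂ) * (b - a)) (b - a) t := fun t => by
    simpa using (Complex.ofRealCLM.hasDerivAt (x := t)).mul_const (b - a) |>.const_add a
  have h := intervalIntegral.integral_eq_sub_of_hasDerivAt (a := 0) (b := 1)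
    (f := fun t : ℝ => P (a + t * (b - a))) (f' := fun t : ℝ => (b - a) * g (a + t * (b - a)))
    (fun t ht => (HasDerivAt.scomp (𝕜 := ℝ) t (hP _ (hmem t ht)) (hline t)))
    (ContinuousOn.intervalIntegrable <| continuousOn_const.mul <|
      hg.comp (by fun_prop) fun t ht => hmem t ht)
  rw [segmentIntegral, h]
  simp

/-- `L` plays the role of a primitive of `g` pulled back along `h`. Passing to a nearby map `h'`
adds the integral over the segment from `h x` to `h' x`. For y near x, all four points `h x`, `h y`,
`h' x`, `h' y` lie in a ball where `g` has a genuine primitive, so the increments match. -/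
lemma exists_lift_of_dist_lt {X : Type*} [TopologicalSpace X] {U : Set ℂ} {g : ℂ → ℂ}
    (hg : DifferentiableOn ℂ g U) {h h' : X → ℂ} (hh : Continuous h) (hh' : Continuous h') {δ : ℝ}
    (hU : ∀ x, Metric.ball (h x) δ ⊆ U) (hδ : ∀ x, dist (h' x) (h x) < δ)
    (hL : ∃ L : X → ℂ, ∀ x, ∀ᶠ y in 𝓝 x, L y - L x = segmentIntegral g (h x) (h y)) :
    ∃ L : X → ℂ, ∀ x, ∀ᶠ y in 𝓝 x, L y - L x = segmentIntegral g (h' x) (h' y) := by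
  obtain ⟨L, hL⟩ := hL
  refine ⟨fun x => L x + segmentIntegral g (h x) (h' x), fun x => ?_⟩
  have hgW := hg.mono (hU x)
  obtain ⟨P, hP⟩ := hgW.isExactOn_ball
  have hx : h x ∈ Metric.ball (h x) δ := Metric.mem_ball_self (dist_nonneg.trans_lt (hδ x))
  have hx' : h' x ∈ Metric.ball (h x) δ := hδ x
  have hseg : ∀ a ∈ Metric.ball (h x) δ, ∀ b ∈ Metric.ball (h x) δ,
      segmentIntegral g a b = P b - P a := fun a ha b hb =>
    segmentIntegral_eq_sub (convex_ball _ _) hgW.continuousOn hP ha hb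
  filter_upwards [hL x, hh.continuousAt.eventually_mem (Metric.isOpen_ball.mem_nhds hx),
    hh'.continuousAt.eventually_mem (Metric.isOpen_ball.mem_nhds hx')] with y hy h1 h2
  have : L y = L x + segmentIntegral g (h x) (h y) := by rw [← hy]; ring
  rw [this, hseg _ hx _ h1, hseg _ h1 _ h2, hseg _ hx _ hx', hseg _ hx' _ h2]
  ring

/-- A holomorphic function on a contractible open set has a primitive near every compact subset. -/
theorem exists_primitive_of_contractible {U K : Set ℂ} (hUo : IsOpen U) (hUc : ContractibleSpace U)
    (hK : IsCompact K) (hKU : K ⊆ U) {g : ℂ → ℂ} (hg : DifferentiableOn ℂ g U) :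
    ∃ G : ℂ → ℂ, ∀ w ∈ interior K, HasDerivAt G (g w) w := by
  obtain ⟨y, ⟨H⟩⟩ := id_nullhomotopic U
  -- Now the homotopy runs from the constant map at `y` to the identity.
  replace H := H.symm
  have : CompactSpace K := isCompact_iff_compactSpace.1 hK
  let Φ : unitInterval × K → ℂ := fun q => (H (q.1, Set.inclusion hKU q.2) : ℂ)
  have hΦ : Continuous Φ := by
    have := continuous_inclusion hKU
    exact continuous_subtype_val.comp (H.continuous.comp (by fun_prop))
  obtain ⟨δ, hδ, hδU⟩ := (isCompact_range hΦ).exists_thickening_subset_open hUo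
    (by rintro _ ⟨q, rfl⟩; exact (H (q.1, Set.inclusion hKU q.2)).2)
  have hball : ∀ q, Metric.ball (Φ q) δ ⊆ U := fun q =>
    (Metric.ball_subset_thickening (Set.mem_range_self q) δ).trans hδU
  obtain ⟨ε, hε, hεδ⟩ := Metric.uniformContinuous_iff.1
    (CompactSpace.uniformContinuous_of_continuous hΦ) δ hδ
  -- Times advancing by ε/2 and clamped at 1. Consecutive maps `Φ (T n, ·)` are then uniformly less
  -- than `δ` apart, as the previous lemma requires.
  let T : ℕ → unitInterval := fun n => Set.projIcc 0 1 zero_le_one (n * (ε / 2))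
  have hT : ∀ n, dist (T (n + 1)) (T n) < ε := fun n => by
    refine lt_of_le_of_lt ((LipschitzWith.projIcc zero_le_one).dist_le_mul _ _) ?_
    rw [NNReal.coe_one, one_mul, Real.dist_eq]
    push_cast
    rw [add_mul, one_mul, add_sub_cancel_left, abs_of_pos (by positivity)]
    linarith
  have hlift : ∀ n, ∃ L : K → ℂ, ∀ x, ∀ᶠ w in 𝓝 x,
      L w - L x = segmentIntegral g (Φ (T n, x)) (Φ (T n, w)) := by
    intro n
    induction n with
    | zero =>
      refine ⟨fun _ => 0, fun x => Eventually.of_forall fun w => ?_⟩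
      have hT0 : T 0 = 0 := by simp only [T, Nat.cast_zero, zero_mul]; exact Set.projIcc_of_le_left _ le_rfl
      have hΦ0 : ∀ w, Φ (0, w) = y := fun w => by simp [Φ]
      simp [hT0, hΦ0, segmentIntegral]
    | succ n ih =>
      refine exists_lift_of_dist_lt hg (by fun_prop) (by fun_prop) (fun x => hball (T n, x))
        (fun x => hεδ ?_) ih
      rw [Prod.dist_eq, dist_self]
      exact max_lt (hT n) hε
  obtain ⟨n, hn⟩ := exists_nat_ge (1 / (ε / 2))
  have hT1 : T n = 1 := Set.projIcc_of_right_le _ ((div_le_iff₀ (by positivity)).1 hn)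
  have hΦ1 : ∀ w : K, Φ (1, w) = w := fun w => by simp [Φ]
  obtain ⟨L, hL⟩ := hlift n
  simp only [hT1, hΦ1] at hL
  classical
  -- At time 1 the map is the inclusion, so `L` is a local primitive on `K`. The value off `K` is
  -- irrelevant: derivatives are taken only at interior points.
  refine ⟨fun w => if h : w ∈ K then L ⟨w, h⟩ else 0, fun x hx => ?_⟩
  have hxK := interior_subset hx
  obtain ⟨ρ, hρ, hρU⟩ := Metric.isOpen_iff.1 hUo x (hKU hxK)
  have hgW := hg.mono hρU
  obtain ⟨P, hP⟩ := hgW.isExactOn_ball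
  have hL' : ∀ᶠ w in 𝓝[K] x, ∀ h : w ∈ K, L ⟨w, h⟩ - L ⟨x, hxK⟩ = segmentIntegral g x w := by
    have h := hL ⟨x, hxK⟩
    rw [nhds_subtype_eq_comap, eventually_comap] at h
    filter_upwards [nhdsWithin_le_nhds h] with w hw hwK using hw ⟨w, hwK⟩ rfl
  rw [nhdsWithin_eq_nhds.2 (mem_interior_iff_mem_nhds.1 hx)] at hL'
  refine ((hP x (Metric.mem_ball_self hρ)).add_const (L ⟨x, hxK⟩ - P x)).congr_of_eventuallyEq ?_
  filter_upwards [hL', mem_interior_iff_mem_nhds.1 hx, Metric.ball_mem_nhds x hρ] with w h1 h2 h3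
  have h4 := h1 h2
  rw [segmentIntegral_eq_sub (convex_ball _ _) hgW.continuousOn hP (Metric.mem_ball_self hρ) h3]
    at h4
  rw [dif_pos h2]
  linear_combination h4

end Primitive

/-! ### Holomorphic forms near the support; Cauchy's theorem. -/

section Cauchy

lemma contDiff_cutoff_smul {O : Set ℂ} (hO : IsOpen O) {χ : ℂ → ℝ} (hχ : ContDiff ℝ ∞ χ)
    (hs : tsupport χ ⊆ O) {g : ℂ → ℂ} (hg : DifferentiableOn ℂ g O) :
    ContDiff ℝ ∞ fun w => χ w • g w := by
  refine contDiff_iff_contDiffAt.2 fun x => ?_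
  by_cases hx : x ∈ tsupport χ
  · exact hχ.contDiffAt.smul
      (((hg.contDiffOn hO).contDiffAt (hO.mem_nhds (hs hx))).restrict_scalars ℝ)
  · refine (contDiffAt_const (c := (0 : ℂ))).congr_of_eventuallyEq ?_
    filter_upwards [(isClosed_tsupport χ).isOpen_compl.mem_nhds hx] with w hw
    rw [image_eq_zero_of_notMem_tsupport hw, zero_smul]

lemma isClosed_supp {V : Type*} [NormedAddCommGroup V] [NormedSpace ℝ V] {r : ℕ}
    (J : Chain r V) : IsClosed (supp J) :=
  isClosed_sInter fun _ hX => hX.1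

lemma exists_isExtensionNear_holForm {r : ℕ} {J : Chain r ℂ} (hJ : IsCompact (supp J)) {O : Set ℂ}
    (hO : IsOpen O) (hJO : supp J ⊆ O) {g : ℂ → ℂ} (hg : DifferentiableOn ℂ g O) :
    ∃ η, IsExtensionNear J (holForm g) η := by
  obtain ⟨χ, hχ, hχc, hχO, hχ1⟩ := exists_cutoff hJ hO hJO
  have hs : ContDiff ℝ ∞ (holForm fun w => χ w • g w) :=
    (contDiff_cutoff_smul hO hχ hχO hg).smul contDiff_const
  have hc : HasCompactSupport fun w => χ w • g w := hχc.smul_right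
  have hc' : HasCompactSupport (holForm fun w => χ w • g w) :=
    hc.comp_left (g := fun y : ℂ => y • ContinuousLinearMap.id ℝ ℂ) (by ext; simp)
  refine ⟨holForm fun w => χ w • g w, isBForm_of_hasCompactSupport r hs hc', ?_⟩
  filter_upwards [hχ1] with w hw
  simp only [holForm, hw, one_smul]

/-- Cauchy's theorem: a holomorphic form on a contractible open set has an extension which
integrates to zero over closed chains. -/
theorem exists_isExtensionNear_integralB_eq_zero {r : ℕ} (hr : 1 ≤ r) {J : Chain r ℂ}
    (hJ : IsCompact (supp J)) (hJ_closed : boundary J = 0) {U : Set ℂ} (hUo : IsOpen U)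
    (hUc : ContractibleSpace U) (hJU : supp J ⊆ U) {g : ℂ → ℂ} (hg : DifferentiableOn ℂ g U) :
    ∃ η, IsExtensionNear J (holForm g) η ∧ integralB η J = 0 := by
  obtain ⟨L, hL, hJL, hLU⟩ := exists_compact_between hJ hUo hJU
  obtain ⟨G, hG⟩ := exists_primitive_of_contractible hUo hUc hL hLU hg
  obtain ⟨χ, hχ, hχc, hχL, hχ1⟩ := exists_cutoff hJ isOpen_interior hJL
  have hs := contDiff_cutoff_smul isOpen_interior hχ hχL fun w hw =>
    (hG w hw).differentiableAt.differentiableWithinAt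
  have hc : HasCompactSupport fun w => χ w • G w := hχc.smul_right
  refine ⟨fderiv ℝ fun w => χ w • G w, ⟨isBForm_of_hasCompactSupport r
    (hs.fderiv_right (m := ∞) (by simp)) (hc.fderiv ℝ), ?_⟩, ?_⟩
  -- To differentiate the product at `w`, the cutoff must be 1 on a whole neighbourhood of `w`.
  · filter_upwards [hχ1.eventually_nhdsSet, isOpen_interior.mem_nhdsSet.2 hJL]
      with w hw hwL
    have he : (fun w => χ w • G w) =ᶠ[𝓝 w] G := by
      filter_upwards [hw] with v hv
      rw [hv, one_smul]
    rw [he.fderiv_eq, ((hG w hwL).hasFDerivAt.restrictScalars ℝ).fderiv]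
    ext
    simp [holForm, mul_comm]
  · rw [← integralB_boundary hr hs hc, hJ_closed]
    exact map_zero (extend (r + 1) (evalPointed _))

end Cauchy

end DiffChain

end

/-! ### The Cauchy integral formula. -/

theorem mainTheorem3
    (U : Set ℂ) (hU_bdd : Bornology.IsBounded U) (hU_open : IsOpen U)
    (hU_contr : ContractibleSpace U)
    (f : ℂ → ℂ) (hf : DifferentiableOn ℂ f U)
    (r : ℕ) (hr : 1 ≤ r) (J : DiffChain.Chain r ℂ)
    (hJ_closed : DiffChain.boundary J = 0) (hJ_supp : DiffChain.supp J ⊆ U)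
    (z : ℂ) (hz : z ∈ U \ DiffChain.supp J) :
    DiffChain.HarrisonIntegrable J (DiffChain.holForm fun w => 1 / (w - z)) ∧
    DiffChain.HarrisonIntegrable J (DiffChain.holForm fun w => f w / (w - z)) ∧
    DiffChain.windingNumber J z * f z =
      1 / (2 * Real.pi * Complex.I) *
        DiffChain.harrisonIntegral J (DiffChain.holForm fun w => f w / (w - z)) := by
  open DiffChain in
  have hJ : IsCompact (supp J) :=
    Metric.isCompact_of_isClosed_isBounded (isClosed_supp J) (hU_bdd.subset hJ_supp)
  have hJz : supp J ⊆ {z}ᶜ := fun w hw hwz => hz.2 (hwz ▸ hw)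
  obtain ⟨η, hη⟩ := exists_isExtensionNear_holForm hJ isOpen_compl_singleton hJz
    (g := fun w => 1 / (w - z)) (DifferentiableOn.div (by fun_prop) (by fun_prop)
      fun w hw => sub_ne_zero.2 hw)
  -- `dslope f z` is the difference quotient with its singularity at `z` removed, hence holomorphic
  -- on `U`.
  obtain ⟨θ, hθ, hθ0⟩ := exists_isExtensionNear_integralB_eq_zero hr hJ hJ_closed hU_open hU_contr
    hJ_supp ((Complex.differentiableOn_dslope (hU_open.mem_nhds hz.1)).2 hf)
  have hmul := integralB_comp (f z • ContinuousLinearMap.id ℝ ℂ) hη.1 J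
  -- Near `supp J`, which avoids `z`, f(w)/(w - z) equals f(z)/(w - z) plus the difference quotient.
  have hext : IsExtensionNear J (holForm fun w => f w / (w - z))
      ((fun p => (f z • ContinuousLinearMap.id ℝ ℂ).comp (η p)) + θ) := by
    refine ⟨hmul.1.add hθ.1, ?_⟩
    filter_upwards [hη.2, hθ.2, isOpen_compl_singleton.mem_nhdsSet.2 hJz] with w h1 h2 h3
    have h3 : w - z ≠ 0 := sub_ne_zero.2 h3
    rw [Pi.add_apply, h1, h2]
    ext
    simp [holForm, dslope_of_ne _ (sub_ne_zero.1 h3), slope_def_field]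
    field_simp
    ring
  refine ⟨⟨_, hη.hasHarrisonIntegral⟩, ⟨_, hext.hasHarrisonIntegral⟩, ?_⟩
  rw [windingNumber, hη.harrisonIntegral_eq, hext.harrisonIntegral_eq,
    integralB_add hmul.1 hθ.1, hmul.2, hθ0]
  simp
  ring
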